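/- Let $S$ be a finite set with a total order $<$, and let $M$ be a matroid on the ground set $S$ without loops and without parallel elements, with set of circuits $\mathfrak M$ and rank $\mathrm{rk}$. For a commutative ring $R$ with $1$, an element $q\in R$ and a family $\mathfrak N$ of subsets of $S$, let $G_q(\mathfrak N)$ be the set of the following elements of the free associative algebra $R\langle t_s\mid s\in S\rangle$: $$t_s^2-q\ (s\in S),\qquad t_rt_s+t_st_r-2q\ (s<r),\qquad t^-_J=\sum_{I\subseteq J,\ \#I\text{ odd}}(-1)^{\ell_J(I)}(-q)^{(\#I-1)/2}\,t_{J\setminus I}\ (J\in\mathfrak N).$$ Here $t_J=t_{j_1}\cdots t_{j_n}$ for $J=\{j_1<\dots<j_n\}$, and $\ell_J(I)=\sum_\nu(\alpha_\nu-\nu)$ for $I=\{j_{\alpha_1}<j_{\alpha_2}<\cdots\}\subseteq J$. Let $I_q(\mathfrak N)$ be the two-sided ideal generated by $G_q(\mathfrak N)$, and let $OS_q(M)=R\langle t_s\mid s\in S\rangle/I_q(\mathfrak M)$. For $q=0$ and $R=k$ a field this is the Orlik–Solomon algebra of $M$ over $k$, graded by $\deg t_s=1$. Order the subsets of $S$ by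 $K\prec J$ if $\#K<\#J$, or if $\#K=\#J$, $K\ne J$ and the least element of the symmetric difference of $K$ and $J$ lies in $K$. For $J\subseteq S$ let $J'$ be $J$ without its least element. A subset of $S$ is dependent if it contains a circuit. The set $\overline{\mathfrak M}$ of Gröbner circuits is defined recursively: a dependent set $J$ belongs to $\overline{\mathfrak M}$ if and only if there is no $K\in\overline{\mathfrak M}$ with $K\prec J$ such that $K'$ is a convex subset of $J'$ (that is, $K'\subseteq J'$, and every $j\in J'$ with $k<j<k'$ for some $k,k'\in K'$ lies in $K'$). A broken circuit is a set $C'$ with $C\in\mathfrak M$. Let $c_i$ be the number of $i$-element subsets of $S$ that contain no broken circuit. Let $Q$ be a commutative ring with $1$, let $R=Q[t_0]$ with $t_0$ a variable of degree one, and let $q=t_0^2$. Then: 1. The set $G_q(\overline{\mathfrak M})$ is a Gröbner basis of the ideal $I_q(\mathfrak M)$ of $Q\langle t_s\mid s\in S\rangle[t_0]$: it is contained in $I_q(\mathfrak M)$, and the leading terms of its nonzero elements generate the same two-sided ideal as the leading terms of all nonzero elements of $I_q(\mathfrak M)$. Here the monomials $t_0^iw$ ($w$ a word in the $t_s$), read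 as words in the letters $t_0$ and $t_s$ $(s\in S)$ with $t_0$ the least letter, are ordered degree lexicographically (first by length, then lexicographically from the left), and a leading term includes its coefficient in $Q$. The algebra $OS_q(M)$ is a free $Q$-module, and, with $\deg t_0=\deg t_s=1$, it is a standard graded $Q$-algebra (its degree zero part is $Q$, and it is generated over $Q$ by its degree one part, which is a finitely generated $Q$-module). Each of its homogeneous components is a free $Q$-module of finite rank. 2. If $Q\neq0$, the Hilbert series of $OS_q(M)$ as a $Q$-algebra (the generating function of the ranks of its homogeneous components) is $$\frac{1+c_1z+\dots+c_{\mathrm{rk}}z^{\mathrm{rk}}}{1-z}=\mathrm{Hilb}_M(z)\cdot\frac1{1-z},$$ where $\mathrm{Hilb}_M(z)$ is the Hilbert series of the Orlik–Solomon algebra of $M$, which is a standard graded $k$-algebra, over an arbitrary field $k$. -/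

import Mathlib

open scoped PowerSeries

namespace OSDeform

noncomputable section

universe u v w

/-! ### Combinatorics of subsets of a totally ordered finite set -/

section Combinatorics

variable {S : Type u} [LinearOrder S]

/-- `J` with its least element removed (the empty set if `J` is empty). -/
def eraseMin (J : Finset S) : Finset S := {j ∈ J | ∃ i ∈ J, i < j}

/-- The degree lexicographic order on words in a totally ordered alphabet: shorter words come
first, and words of equal length are compared lexicographically from the left. -/
def WordLT {α : Type u} [LT α] (v w : List α) : Prop := List.Shortlex (· < ·) v w

/-- The degree lexicographic order on subsets of `S`, induced from the order on words by
`J = {j₁ < ⋯ < jₙ} ↦ j₁ ⋯ jₙ`. -/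
def SubsetLT (K J : Finset S) : Prop := WordLT (K.sort (· ≤ ·)) (J.sort (· ≤ ·))

theorem subsetLT_wf [Finite S] : WellFounded (SubsetLT (S := S)) :=
  InvImage.wf (fun J : Finset S => J.sort (· ≤ ·))
    (List.Shortlex.wf (IsWellFounded.wf : WellFounded ((· < ·) : S → S → Prop)))

/-- `K` is a convex subset of `J`. -/
def ConvexSubset (K J : Finset S) : Prop :=
  K ⊆ J ∧ ∀ j ∈ J, ∀ k ∈ K, ∀ k' ∈ K, k < j → j < k' → j ∈ K

/-- A subset of `S` is dependent with respect to a set system `𝓜` if it contains a member of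
`𝓜`. -/
def Dependent (𝓜 : Set (Finset S)) (J : Finset S) : Prop := ∃ C ∈ 𝓜, C ⊆ J

/-- Gröbner circuits, defined by recursion along the degree lexicographic order: a dependent set
`J` is a Gröbner circuit if and only if for no smaller Gröbner circuit `K` the set `K` minus its
least element is a convex subset of `J` minus its least element. -/
def IsGroebnerCircuit [Finite S] (𝓜 : Set (Finset S)) (J : Finset S) : Prop :=
  Dependent 𝓜 J ∧ ∀ K : Finset S, SubsetLT K J → IsGroebnerCircuit 𝓜 K →
    ¬ ConvexSubset (eraseMin K) (eraseMin J)
termination_by subsetLT_wf.wrap J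
decreasing_by assumption

/-- The set of Gröbner circuits of the set system `𝓜`. -/
def groebnerCircuits [Finite S] (𝓜 : Set (Finset S)) : Set (Finset S) :=
  {J | IsGroebnerCircuit 𝓜 J}

/-- The set of circuits of a matroid on the finite set `S`, as finsets. -/
def circuits (M : Matroid S) : Set (Finset S) := {C | M.IsCircuit (C : Set S)}

/-- The number of `i`-element subsets of `S` that contain no broken circuit, a broken circuit
being a circuit with its least element removed. -/
def nbcCount (M : Matroid S) (i : ℕ) : ℕ :=
  Set.ncard {J : Finset S | J.card = i ∧ ∀ C ∈ circuits M, ¬ eraseMin C ⊆ J}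

/-- `ℓ_J(I) = ∑ (α_ν - ν)` for `I = {j_{α_1} < j_{α_2} < ⋯} ⊆ J = {j_1 < j_2 < ⋯}`. The element
`i = j_{α_ν}` of `I` has position `α_ν = #{j ∈ J | j ≤ i}` in `J` and `ν = #{j ∈ I | j ≤ i}` in
`I`; as `I ⊆ J` the subtraction does not truncate. -/
def ell (J I : Finset S) : ℕ :=
  ∑ i ∈ I, (({j ∈ J | j ≤ i} : Finset S).card - ({j ∈ I | j ≤ i} : Finset S).card)

end Combinatorics

/-! ### The deformation of the Orlik–Solomon algebra -/

section Algebra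

variable {R : Type v} [CommRing R] {S : Type u} [LinearOrder S]

/-- The variable `t_s` of the free associative algebra `R⟨t_s | s ∈ S⟩`. -/
def tVar (R : Type v) [CommRing R] {S : Type u} (s : S) : FreeAlgebra R S := FreeAlgebra.ι R s

/-- The monomial `t_J = t_{j₁} ⋯ t_{jₙ}` for `J = {j₁ < ⋯ < jₙ}`. -/
def tMon (R : Type v) [CommRing R] (J : Finset S) : FreeAlgebra R S :=
  ((J.sort (· ≤ ·)).map (tVar R)).prod

/-- The element `t⁻_J = ∑ (-1)^{ℓ_J(I)} (-q)^{(#I-1)/2} t_{J ∖ I}`, the sum being over all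
`I ⊆ J` of odd cardinality. -/
def tMinus (q : R) (J : Finset S) : FreeAlgebra R S :=
  ∑ I ∈ J.powerset with Odd I.card, ((-1) ^ ell J I * (-q) ^ ((I.card - 1) / 2)) • tMon R (J \ I)

/-- The generators `t_s² - q`, `t_r t_s + t_s t_r - 2q` for `s < r`, and `t⁻_J` for `J ∈ 𝓜`. -/
def generators (q : R) (𝓜 : Set (Finset S)) : Set (FreeAlgebra R S) :=
  {f | ∃ s : S, f = tVar R s ^ 2 - algebraMap R _ q} ∪
  {f | ∃ r s : S, s < r ∧ f = tVar R r * tVar R s + tVar R s * tVar R r - algebraMap R _ (2 * q)} ∪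
  {f | ∃ J ∈ 𝓜, f = tMinus q J}

/-- The two-sided ideal `I_q(𝓜)`. -/
def defIdeal (q : R) (𝓜 : Set (Finset S)) : TwoSidedIdeal (FreeAlgebra R S) :=
  TwoSidedIdeal.span (generators q 𝓜)

/-- The algebra `OS_q(𝓜) = R⟨t_s | s ∈ S⟩ / I_q(𝓜)`. -/
abbrev OSq (q : R) (𝓜 : Set (Finset S)) : Type (max u v) :=
  (defIdeal q 𝓜).ringCon.Quotient

/-- The class in `OS_q(𝓜)` of an element of the free algebra. -/
def OSq.mk (q : R) (𝓜 : Set (Finset S)) : FreeAlgebra R S →+* OSq q 𝓜 :=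
  (defIdeal q 𝓜).ringCon.mk'

end Algebra

/-! ### Gröbner bases in `Q⟨t_s | s ∈ S⟩[t₀]`

The ring `Q⟨t_s | s ∈ S⟩[t₀]` with central variable `t₀` is `Q[t₀]⟨t_s | s ∈ S⟩`, i.e.
`FreeAlgebra (Polynomial Q) S`. Its monomials over `Q` are `t₀ⁱ w` with `w` a word in the
`t_s`. -/

section Groebner

variable {Q : Type v} [CommRing Q] {S : Type u} [LinearOrder S]

/-- The term `c t₀ⁱ w`, for `m = (i, w)`. -/
def monTerm (c : Q) (m : ℕ × FreeMonoid S) : FreeAlgebra (Polynomial Q) S :=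
  Polynomial.monomial m.1 c • FreeAlgebra.basisFreeMonoid (Polynomial Q) S m.2

/-- The coefficient in `Q` of `f` at the monomial `t₀ⁱ w`, for `m = (i, w)`. -/
def coeffAt (f : FreeAlgebra (Polynomial Q) S) (m : ℕ × FreeMonoid S) : Q :=
  ((FreeAlgebra.basisFreeMonoid (Polynomial Q) S).repr f m.2).coeff m.1

/-- The monomial `t₀ⁱ w` as a word in the alphabet `S ∪ {t₀}`, in which `t₀` (written `⊥`) is the
least letter. -/
def toWord (m : ℕ × FreeMonoid S) : List (WithBot S) :=
  List.replicate m.1 ⊥ ++ m.2.toList.map (fun s => (s : WithBot S))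

/-- `g` is the leading term (coefficient times monomial) of the nonzero element `f` with respect
to the degree lexicographic order in which `t₀` is the least variable. -/
def IsLeadingTerm (f g : FreeAlgebra (Polynomial Q) S) : Prop :=
  ∃ m : ℕ × FreeMonoid S, coeffAt f m ≠ 0 ∧
    (∀ m', coeffAt f m' ≠ 0 → m' ≠ m → WordLT (toWord m') (toWord m)) ∧
    g = monTerm (coeffAt f m) m

/-- The set of leading terms of the nonzero elements of `F`. -/
def leadingTerms (F : Set (FreeAlgebra (Polynomial Q) S)) : Set (FreeAlgebra (Polynomial Q) S) :=
  {g | ∃ f ∈ F, IsLeadingTerm f g}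

/-- `G` is a Gröbner basis of the two-sided ideal `I`: it is a subset of `I` and the leading terms
of its elements generate the same two-sided ideal as the leading terms of all elements of `I`. -/
def IsGroebnerBasis (G : Set (FreeAlgebra (Polynomial Q) S))
    (I : TwoSidedIdeal (FreeAlgebra (Polynomial Q) S)) : Prop :=
  (∀ g ∈ G, g ∈ I) ∧
    TwoSidedIdeal.span (leadingTerms G) = TwoSidedIdeal.span (leadingTerms {f | f ∈ I})

end Groebner

/-! ### Gradings and Hilbert series -/

section Grading

/-- `𝒜` is a grading of the `K`-algebra `A` by `ℕ` making it a standard graded `K`-algebra: the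
degree zero part is `K`, and `A` is generated as a `K`-algebra by the degree one part, which is a
finitely generated `K`-module. -/
structure IsStandardGraded (K : Type v) {A : Type w} [CommRing K] [Ring A] [Algebra K A]
    (𝒜 : ℕ → Submodule K A) : Prop where
  gradedMonoid : SetLike.GradedMonoid 𝒜
  isInternal : DirectSum.IsInternal 𝒜
  algebraMap_injective : Function.Injective (algebraMap K A)
  degree_zero : (𝒜 0 : Set A) = Set.range (algebraMap K A)
  degree_one_finite : Module.Finite K (𝒜 1)
  generated : Algebra.adjoin K (𝒜 1 : Set A) = ⊤

/-- The Hilbert series `∑ rank_K(𝒜 n) zⁿ`. -/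
def hilbertSeries (K : Type v) {A : Type w} [CommRing K] [Ring A] [Algebra K A]
    (𝒜 : ℕ → Submodule K A) : ℚ⟦X⟧ :=
  PowerSeries.mk fun n => (Module.finrank K (𝒜 n) : ℚ)

variable {S : Type u} [LinearOrder S]

/-- For `R = Q[t₀]` and `q = t₀²`, the part of degree `n` of `OS_q(𝓜)`: the `Q`-span of the classes
of the monomials `t₀ⁱ w` with `i + |w| = n`. -/
def homogPart (Q : Type v) [CommRing Q] (𝓜 : Set (Finset S)) (n : ℕ) :
    Submodule Q (OSq (Polynomial.X ^ 2 : Polynomial Q) 𝓜) :=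
  Submodule.span Q
    {x | ∃ m : ℕ × FreeMonoid S, m.1 + m.2.length = n ∧ x = OSq.mk _ 𝓜 (monTerm 1 m)}

/-- The Orlik–Solomon algebra over `k`, i.e. `OS_q(𝓜)` for `R = k` and `q = 0`. -/
abbrev OrlikSolomon (k : Type v) [CommRing k] (𝓜 : Set (Finset S)) : Type (max u v) :=
  OSq (0 : k) 𝓜

/-- The part of degree `n` of the Orlik–Solomon algebra over `k`: the `k`-span of the classes of
the words of length `n`. -/
def osPart (k : Type v) [CommRing k] (𝓜 : Set (Finset S)) (n : ℕ) :
    Submodule k (OrlikSolomon k 𝓜) :=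
  Submodule.span k
    {x | ∃ v : FreeMonoid S, v.length = n ∧
      x = OSq.mk _ 𝓜 (FreeAlgebra.basisFreeMonoid k S v)}

end Grading

end

end OSDeform

open OSDeform

/-! Write J' for J without its least element a. Splitting the sum that defines t⁻_J by whether I
contains a gives a recursion for t⁻ and its even companion t⁺. Modulo t_s² = q and t_r t_s + t_s t_r
= 2q it collapses to t⁻_J = ∏_{x ∈ J'} (t_x - t_a), where the differences square to zero and
anticommute (`CliffordRel.minus_cons`). Hence t⁻_J lies in I_q(𝔐) as soon as J contains a circuit,
so the proposed Gröbner basis lies in the ideal. The leading word of t⁻_J is that of J'.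

Spanning: a word that is not strictly increasing contains a leading word of a quadratic generator. A
strictly increasing word whose set contains a broken circuit has a factor J' with J a Gröbner
circuit (`exists_groebnerCircuit_convexSubset`). So every word reduces to monomials t_K with K free
of broken circuits (nbc), with powers of t₀ as coefficients.

Independence (`exists_dual_form`): an nbc set J defines a flag of flats and so a level for each s ∈
S. Let t_s act on an exterior algebra by wedging with a vector that depends only on the level of s,
plus q times a contraction. Every circuit has two elements of equal level, so every t⁻_C acts as
zero. A determinant in degree #J takes the value 1 on t_J and 0 on t_K for every other nbc K with #K
≤ #J.

The t_K therefore form a basis of the quotient over R for each q = x². The case x = t₀ is the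
deformation and x = 0 the Orlik–Solomon algebra. A leading term of the ideal cannot be a multiple of
t₀ⁱ t_K with K nbc, since the element would have a nonzero coordinate in the quotient; this is the
Gröbner property. The Hilbert series count the pairs (i, K) and the sets K respectively. -/

namespace OSDeform

noncomputable section

universe u v w

/-! ### The elements `t⁻_J` as products of differences -/

section Pair

variable {R : Type v} [CommRing R] {A : Type w} [Ring A] [Algebra R A] {S : Type u}

/-- The pair `(t⁻, t⁺)` attached to a word in elements `t s` of an algebra. -/
def minusPlus (q : R) (t : S → A) : List S → A × A
  | [] => (0, 1)
  | a :: l => ((minusPlus q t l).2 - t a * (minusPlus q t l).1,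
      t a * (minusPlus q t l).2 - q • (minusPlus q t l).1)

theorem map_minusPlus {B : Type*} [Ring B] [Algebra R B] (φ : A →ₐ[R] B) (q : R) (t : S → A)
    (l : List S) :
    φ (minusPlus q t l).1 = (minusPlus q (fun s => φ (t s)) l).1 ∧
      φ (minusPlus q t l).2 = (minusPlus q (fun s => φ (t s)) l).2 := by
  induction l with
  | nil => simp [minusPlus]
  | cons a l ih => simp [minusPlus, ih.1, ih.2]

variable [LinearOrder S]

/-- The companion `t⁺_J` of `t⁻_J`, the analogous sum over the subsets of even cardinality. -/
def tPlus (q : R) (J : Finset S) : FreeAlgebra R S :=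
  ∑ I ∈ J.powerset with Even I.card, ((-1) ^ ell J I * (-q) ^ (I.card / 2)) • tMon R (J \ I)

/-- A new least element of J raises by one the position in J of each element of I and leaves its
position in I alone. -/
theorem ell_insert_left {a : S} {J I : Finset S} (h : ∀ x ∈ J, a < x) (hI : I ⊆ J) :
    ell (insert a J) I = ell J I + I.card := by
  have ha : a ∉ J := fun h' => lt_irrefl _ (h a h')
  rw [ell, ell, Finset.card_eq_sum_ones, ← Finset.sum_add_distrib]
  refine Finset.sum_congr rfl fun i hi => ?_
  rw [Finset.filter_insert, if_pos (h i (hI hi)).le, Finset.card_insert_of_notMem (by simp [ha])]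
  have : ({j ∈ I | j ≤ i} : Finset S).card ≤ ({j ∈ J | j ≤ i} : Finset S).card :=
    Finset.card_le_card (Finset.filter_subset_filter _ hI)
  omega

theorem ell_insert_both {a : S} {J I : Finset S} (h : ∀ x ∈ J, a < x) (hI : I ⊆ J) :
    ell (insert a J) (insert a I) = ell J I := by
  have ha : a ∉ J := fun h' => lt_irrefl _ (h a h')
  have haI : a ∉ I := fun h' => ha (hI h')
  rw [ell, ell, Finset.sum_insert haI]
  have h0 : ∀ K : Finset S, K ⊆ J → ({j ∈ insert a K | j ≤ a} : Finset S) = {a} := by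
    intro K hK
    ext x
    simp only [Finset.mem_filter, Finset.mem_insert, Finset.mem_singleton]
    constructor
    · rintro ⟨rfl | hx, hxa⟩
      · rfl
      · exact absurd (h x (hK hx)) (not_lt.2 hxa)
    · rintro rfl
      simp
  rw [h0 J subset_rfl, h0 I hI, Nat.sub_self, zero_add]
  refine Finset.sum_congr rfl fun i hi => ?_
  rw [Finset.filter_insert, if_pos (h i (hI hi)).le, Finset.card_insert_of_notMem (by simp [ha]),
    Finset.filter_insert, if_pos (h i (hI hi)).le, Finset.card_insert_of_notMem (by simp [haI])]
  omega

theorem tMon_insert {a : S} {J : Finset S} (h : ∀ x ∈ J, a < x) :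
    tMon R (insert a J) = tVar R a * tMon R J := by
  rw [tMon, Finset.sort_insert _ (fun b hb => (h b hb).le) (fun h' => lt_irrefl _ (h a h'))]
  simp [tMon]

/-- The odd sets containing a correspond to even subsets of J and give t⁺_J. For the others the sign
changes by (-1)^{#I} = -1 and t_a splits off on the left. -/
theorem tMinus_insert (q : R) {a : S} {J : Finset S} (h : ∀ x ∈ J, a < x) :
    tMinus q (insert a J) = tPlus q J - tVar R a * tMinus q J := by
  have ha : a ∉ J := fun h' => lt_irrefl _ (h a h')
  rw [tMinus, Finset.sum_filter, Finset.sum_powerset_insert ha, add_comm, sub_eq_add_neg, tPlus,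
    Finset.sum_filter, tMinus, Finset.sum_filter, Finset.mul_sum, ← Finset.sum_neg_distrib]
  congr 1
  · refine Finset.sum_congr rfl fun I hI => ?_
    have hI := Finset.mem_powerset.1 hI
    have haI : a ∉ I := fun h' => ha (hI h')
    rw [Finset.card_insert_of_notMem haI, ell_insert_both h hI, Finset.insert_sdiff_insert,
      Finset.sdiff_insert_of_notMem ha]
    simp [Nat.odd_add_one, Nat.not_odd_iff_even]
  · refine Finset.sum_congr rfl fun I hI => ?_
    have hI := Finset.mem_powerset.1 hI
    have haI : a ∉ I := fun h' => ha (hI h')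
    split_ifs with hodd
    · rw [ell_insert_left h hI, Finset.insert_sdiff_of_notMem _ haI,
        tMon_insert fun x hx => h x (Finset.sdiff_subset hx), pow_add, hodd.neg_one_pow]
      simp
    · simp

theorem tPlus_insert (q : R) {a : S} {J : Finset S} (h : ∀ x ∈ J, a < x) :
    tPlus q (insert a J) = tVar R a * tPlus q J - q • tMinus q J := by
  have ha : a ∉ J := fun h' => lt_irrefl _ (h a h')
  rw [tPlus, Finset.sum_filter, Finset.sum_powerset_insert ha, sub_eq_add_neg, tPlus,
    Finset.sum_filter, tMinus, Finset.sum_filter, Finset.mul_sum, Finset.smul_sum,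
    ← Finset.sum_neg_distrib]
  congr 1
  · refine Finset.sum_congr rfl fun I hI => ?_
    have hI := Finset.mem_powerset.1 hI
    have haI : a ∉ I := fun h' => ha (hI h')
    split_ifs with heven
    · rw [ell_insert_left h hI, Finset.insert_sdiff_of_notMem _ haI,
        tMon_insert fun x hx => h x (Finset.sdiff_subset hx), pow_add, heven.neg_one_pow]
      simp
    · simp
  · refine Finset.sum_congr rfl fun I hI => ?_
    have hI := Finset.mem_powerset.1 hI
    have haI : a ∉ I := fun h' => ha (hI h')
    rw [Finset.card_insert_of_notMem haI, ell_insert_both h hI, Finset.insert_sdiff_insert,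
      Finset.sdiff_insert_of_notMem ha]
    by_cases hodd : Odd I.card
    · obtain ⟨n, hn⟩ := hodd
      -- Adding a to an odd set raises the exponent of -q by one, which is the factor -q in the
      -- recursion.
      have h1 : (I.card + 1) / 2 = (I.card - 1) / 2 + 1 := by omega
      rw [if_pos (by rw [hn]; exact ⟨n + 1, by ring⟩), if_pos ⟨n, hn⟩, h1, smul_smul, ← neg_smul]
      congr 1
      ring
    · rw [if_neg (by rwa [Nat.even_add_one, Nat.not_even_iff_odd]), if_neg hodd]
      simp

theorem tMinus_eq_minusPlus (q : R) (J : Finset S) :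
    tMinus q J = (minusPlus q (tVar R) (J.sort (· ≤ ·))).1 ∧
      tPlus q J = (minusPlus q (tVar R) (J.sort (· ≤ ·))).2 := by
  induction J using Finset.induction_on_min with
  | empty => simp [tMinus, tPlus, minusPlus, Finset.sum_filter, ell, tMon]
  | insert a J h ih =>
    rw [Finset.sort_insert _ (fun b hb => (h b hb).le) (fun h' => lt_irrefl _ (h a h')),
      tMinus_insert q h, tPlus_insert q h, ih.1, ih.2]
    exact ⟨rfl, rfl⟩

end Pair

/-! ### Products of differences under the Clifford relations -/

section Clifford

variable {R : Type v} [CommRing R] {A : Type w} [Ring A] [Algebra R A] {S : Type u}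

/-- The relations `t_s² = q` and `t_r t_s + t_s t_r = 2q`. -/
structure CliffordRel (q : R) (t : S → A) : Prop where
  sq : ∀ s, t s * t s = algebraMap R A q
  anti : ∀ r s, t r * t s + t s * t r = algebraMap R A (2 * q)

variable {q : R} {t : S → A}

theorem CliffordRel.diff_sq (h : CliffordRel q t) (a b : S) : (t b - t a) * (t b - t a) = 0 := by
  have h1 := h.anti a b
  have : (t b - t a) * (t b - t a) = t b * t b + t a * t a - (t a * t b + t b * t a) := by
    noncomm_ring
  rw [this, h1, h.sq, h.sq, ← map_add, ← map_sub]
  simp [two_mul]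

theorem CliffordRel.diff_anti (h : CliffordRel q t) (a x y : S) :
    (t x - t a) * (t y - t a) = - ((t y - t a) * (t x - t a)) := by
  rw [eq_neg_iff_add_eq_zero]
  have : (t x - t a) * (t y - t a) + (t y - t a) * (t x - t a) =
      (t x * t y + t y * t x) + (t a * t a + t a * t a) - (t a * t y + t y * t a) -
        (t a * t x + t x * t a) := by noncomm_ring
  rw [this, h.anti, h.anti, h.anti, h.anti, ← map_add, ← map_sub, ← map_sub]
  convert map_zero (algebraMap R A)
  ring

/-- Multiplying t⁻ = t⁺_l - t_a t⁻_l by t_a on the left and using t_a² = q gives exactly the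
recursion for t⁺. -/
theorem CliffordRel.plus_cons (h : CliffordRel q t) (a : S) (l : List S) :
    (minusPlus q t (a :: l)).2 = t a * (minusPlus q t (a :: l)).1 := by
  simp only [minusPlus, mul_sub, ← mul_assoc, h.sq, Algebra.smul_def]

theorem CliffordRel.minus_cons_cons (h : CliffordRel q t) (a b : S) (l : List S) :
    (minusPlus q t (a :: b :: l)).1 = (t b - t a) * (minusPlus q t (b :: l)).1 := by
  rw [minusPlus, h.plus_cons, sub_mul]

/-- Change of base point: t_x - t_b = (t_x - t_a) - (t_b - t_a), and the second summand is killed by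
the factor t_b - t_a once that factor has been moved next to it by anticommutation. -/
theorem CliffordRel.diff_mul_prod (h : CliffordRel q t) (a b : S) (l : List S) :
    (t b - t a) * (l.map fun x => t x - t b).prod =
      (t b - t a) * (l.map fun x => t x - t a).prod := by
  induction l with
  | nil => rfl
  | cons x l ih =>
    have h1 : (t b - t a) * (t x - t b) = (t b - t a) * (t x - t a) := by
      have : (t b - t a) * (t x - t b) =
        (t b - t a) * (t x - t a) - (t b - t a) * (t b - t a) := by noncomm_ring
      rw [this, h.diff_sq, sub_zero]
    rw [List.map_cons, List.map_cons, List.prod_cons, List.prod_cons, ← mul_assoc, ← mul_assoc, h1,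
      h.diff_anti a b x, neg_mul, neg_mul, mul_assoc, mul_assoc, ih]

theorem CliffordRel.minus_cons (h : CliffordRel q t) (a : S) (l : List S) :
    (minusPlus q t (a :: l)).1 = (l.map fun x => t x - t a).prod := by
  induction l generalizing a with
  | nil => simp [minusPlus]
  | cons b l ih =>
    rw [h.minus_cons_cons, ih b, h.diff_mul_prod, List.map_cons, List.prod_cons]

theorem CliffordRel.prod_mul_diff (h : CliffordRel q t) (a y : S) (l : List S) :
    (t y - t a) * (l.map fun x => t x - t a).prod =
        (l.map fun x => t x - t a).prod * (t y - t a) ∨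
      (t y - t a) * (l.map fun x => t x - t a).prod =
        -((l.map fun x => t x - t a).prod * (t y - t a)) := by
  induction l with
  | nil => simp
  | cons x l ih =>
    rw [List.map_cons, List.prod_cons, ← mul_assoc, h.diff_anti, neg_mul, mul_assoc]
    rcases ih with ih | ih <;> rw [ih] <;> simp [mul_assoc]

/-- A missing factor can be inserted anywhere, since it commutes up to sign with the factors behind
it. The left multiplier z collects the factors already passed. -/
theorem CliffordRel.mul_prod_mem_of_sublist (h : CliffordRel q t) (I : TwoSidedIdeal A) (a : S)
    {l' l : List S} (hl : l'.Sublist l) (z : A)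
    (hz : z * (l'.map fun x => t x - t a).prod ∈ I) :
    z * (l.map fun x => t x - t a).prod ∈ I := by
  induction hl generalizing z with
  | slnil => exact hz
  | cons y _ ih =>
    rw [List.map_cons, List.prod_cons, ← mul_assoc]
    refine ih _ ?_
    rw [mul_assoc]
    rcases h.prod_mul_diff a y _ with e | e <;> rw [e]
    · rw [← mul_assoc]
      exact I.mul_mem_right _ _ hz
    · rw [mul_neg, ← mul_assoc]
      exact I.neg_mem (I.mul_mem_right _ _ hz)
  | cons_cons y _ ih =>
    rw [List.map_cons, List.prod_cons, ← mul_assoc] at hz ⊢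
    exact ih _ hz

/-- Letters in front of c contribute only left factors t_b - t_x. Once c comes first in both words,
both elements are products of differences with the same base point c. -/
theorem CliffordRel.minus_mem_of_sublist (h : CliffordRel q t) (I : TwoSidedIdeal A)
    {c : S} {l' l : List S} (hl : (c :: l').Sublist l)
    (hI : (minusPlus q t (c :: l')).1 ∈ I) : (minusPlus q t l).1 ∈ I := by
  induction l with
  | nil => cases hl
  | cons x l ih =>
    cases hl with
    | cons _ hl =>
      cases l with
      | nil => cases hl
      | cons b l =>
        rw [h.minus_cons_cons]
        exact I.mul_mem_left _ _ (ih hl)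
    | cons_cons _ hl =>
      rw [h.minus_cons] at hI ⊢
      rw [← one_mul (List.prod _)] at hI ⊢
      exact h.mul_prod_mem_of_sublist I _ hl _ hI

/-- This is the previous lemma for the zero ideal and the subword a b, whose t⁻ is t_b - t_a. -/
theorem CliffordRel.minus_eq_zero (h : CliffordRel q t) {a b : S} {l : List S}
    (hl : [a, b].Sublist l) (hab : t a = t b) : (minusPlus q t l).1 = 0 := by
  rw [← TwoSidedIdeal.mem_bot]
  refine h.minus_mem_of_sublist _ hl ?_
  rw [h.minus_cons, TwoSidedIdeal.mem_bot]
  simp [hab]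

end Clifford

/-! ### Broken circuits and Gröbner circuits -/

section Combinatorics

variable {S : Type u} [LinearOrder S]

theorem eraseMin_subset (J : Finset S) : eraseMin J ⊆ J := Finset.filter_subset _ _

theorem eraseMin_insert {a : S} {J : Finset S} (h : ∀ x ∈ J, a < x) :
    eraseMin (insert a J) = J := by
  ext x
  simp only [eraseMin, Finset.mem_filter, Finset.mem_insert, exists_eq_or_imp]
  constructor
  · rintro ⟨rfl | hx, hx' | ⟨i, hi, hx'⟩⟩
    · exact absurd hx' (lt_irrefl _)
    · exact absurd hx' (h i hi).not_gt
    · exact hx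
    · exact hx
  · exact fun hx => ⟨Or.inr hx, Or.inl (h x hx)⟩

theorem exists_eq_insert_eraseMin {J : Finset S} (hJ : J.Nonempty) :
    ∃ a, (∀ x ∈ eraseMin J, a < x) ∧ J = insert a (eraseMin J) := by
  have h : ∀ x ∈ J.erase (J.min' hJ), J.min' hJ < x := fun x hx =>
    lt_of_le_of_ne (J.min'_le x (Finset.mem_of_mem_erase hx)) (Finset.ne_of_mem_erase hx).symm
  have h2 := eraseMin_insert h
  rw [Finset.insert_erase (J.min'_mem hJ)] at h2
  refine ⟨J.min' hJ, by rwa [h2], ?_⟩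
  rw [h2, Finset.insert_erase (J.min'_mem hJ)]

/-- The set `J` contains no set `C'` with `C ∈ 𝓜`. -/
def NoBroken (𝓜 : Set (Finset S)) (J : Finset S) : Prop := ∀ C ∈ 𝓜, ¬ eraseMin C ⊆ J

/-- If C' ⊆ K and a = min C, let U be the set of elements of K above a. Then {a} ∪ U contains C, so
either it is a Gröbner circuit or a smaller one L has L' convex in U. Since U is a final segment of
K, convexity in U implies convexity in K. -/
theorem exists_groebnerCircuit_convexSubset [Finite S] {𝓜 : Set (Finset S)} (h𝓜 : ∅ ∉ 𝓜)
    {K : Finset S} (hK : ¬ NoBroken 𝓜 K) :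
    ∃ J ∈ groebnerCircuits 𝓜, J.Nonempty ∧ ConvexSubset (eraseMin J) K := by
  simp only [NoBroken, not_forall, not_not] at hK
  obtain ⟨C, hC, hCK⟩ := hK
  have hne : ∀ J, IsGroebnerCircuit 𝓜 J → J.Nonempty := by
    intro J hJ
    rw [IsGroebnerCircuit] at hJ
    obtain ⟨D, hD, hDJ⟩ := hJ.1
    rcases D.eq_empty_or_nonempty with rfl | h
    · exact absurd hD h𝓜
    · exact h.mono hDJ
  obtain ⟨a, ha, hCa⟩ := exists_eq_insert_eraseMin
    (Finset.nonempty_iff_ne_empty.2 fun h => h𝓜 (h ▸ hC) : C.Nonempty)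
  have hU : ∀ x ∈ K.filter (a < ·), a < x := fun x hx => (Finset.mem_filter.1 hx).2
  have hconv : ∀ L, ConvexSubset L (K.filter (a < ·)) → ConvexSubset L K := by
    intro L hL
    refine ⟨hL.1.trans (Finset.filter_subset _ _), fun j hj k hk k' hk' h1 h2 => ?_⟩
    exact hL.2 j (Finset.mem_filter.2 ⟨hj, (hU k (hL.1 hk)).trans h1⟩) k hk k' hk' h1 h2
  by_cases hJ : IsGroebnerCircuit 𝓜 (insert a (K.filter (a < ·)))
  · refine ⟨_, hJ, hne _ hJ, ?_⟩
    rw [eraseMin_insert hU]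
    exact hconv _ ⟨subset_rfl, fun j hj _ _ _ _ _ _ => hj⟩
  · rw [IsGroebnerCircuit, not_and_or] at hJ
    have hdep : Dependent 𝓜 (insert a (K.filter (a < ·))) := by
      refine ⟨C, hC, ?_⟩
      rw [hCa]
      exact Finset.insert_subset_insert _ fun x hx => Finset.mem_filter.2 ⟨hCK hx, ha x hx⟩
    have hJ := hJ.resolve_left (not_not.2 hdep)
    push Not at hJ
    obtain ⟨L, -, hL, hLc⟩ := hJ
    rw [eraseMin_insert hU] at hLc
    exact ⟨L, hL, hne _ hL, hconv _ hLc⟩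

theorem sort_eq_append {A B : Finset S} (h : ∀ a ∈ A, ∀ b ∈ B, a < b) :
    (A ∪ B).sort (· ≤ ·) = A.sort (· ≤ ·) ++ B.sort (· ≤ ·) := by
  refine List.Perm.eq_of_pairwise' (r := (· ≤ ·)) (Finset.pairwise_sort _ _) ?_ ?_
  · rw [List.pairwise_append]
    exact ⟨Finset.pairwise_sort _ _, Finset.pairwise_sort _ _, fun a ha b hb =>
      (h a ((Finset.mem_sort _).1 ha) b ((Finset.mem_sort _).1 hb)).le⟩
  · rw [List.perm_ext_iff_of_nodup (Finset.sort_nodup _ _)]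
    · simp
    · refine List.nodup_append.2 ⟨Finset.sort_nodup _ _, Finset.sort_nodup _ _, ?_⟩
      exact fun a ha b hb =>
        (h a ((Finset.mem_sort _).1 ha) b ((Finset.mem_sort _).1 hb)).ne

/-- Convexity of sets is divisibility of words: K splits into the elements below all of L, L itself,
and the rest, which convexity forces to lie above L. -/
theorem ConvexSubset.sort_eq {L K : Finset S} (h : ConvexSubset L K) :
    ∃ l₁ l₂, K.sort (· ≤ ·) = l₁ ++ L.sort (· ≤ ·) ++ l₂ := by
  set A := {x ∈ K | x ∉ L ∧ ∀ y ∈ L, x < y} with hA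
  set B := {x ∈ K | x ∉ L ∧ ¬ ∀ y ∈ L, x < y} with hB
  have hK : K = A ∪ L ∪ B := by
    ext x
    simp only [hA, hB, Finset.mem_union, Finset.mem_filter]
    have := @h.1 x
    tauto
  have hAL : ∀ a ∈ A, ∀ b ∈ L, a < b := fun a ha => (Finset.mem_filter.1 ha).2.2
  have hLB : ∀ a ∈ L, ∀ b ∈ B, a < b := by
    intro a ha b hb
    obtain ⟨hbK, hbL, hb⟩ := Finset.mem_filter.1 hb
    push Not at hb
    obtain ⟨y, hy, hyb⟩ := hb
    by_contra hba
    have hba := lt_of_le_of_ne (not_lt.1 hba) (fun e => hbL (e ▸ ha))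
    exact hbL (h.2 b hbK y hy a ha (lt_of_le_of_ne hyb fun e => hbL (e ▸ hy)) hba)
  have hAB : ∀ a ∈ A, ∀ b ∈ B, a < b := by
    intro a ha b hb
    obtain ⟨-, -, hb'⟩ := Finset.mem_filter.1 hb
    push Not at hb'
    obtain ⟨y, hy, hyb⟩ := hb'
    exact (hAL a ha y hy).trans (hLB y hy b hb)
  refine ⟨A.sort (· ≤ ·), B.sort (· ≤ ·), ?_⟩
  rw [← sort_eq_append hAL, ← sort_eq_append, ← hK]
  intro a ha
  rcases Finset.mem_union.1 ha with ha | ha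
  · exact hAB a ha
  · exact hLB a ha

theorem sort_sublist_sort {I J : Finset S} (h : I ⊆ J) :
    (I.sort (· ≤ ·)).Sublist (J.sort (· ≤ ·)) := by
  refine List.sublist_of_subperm_of_pairwise (r := (· ≤ ·)) ?_ (Finset.pairwise_sort _ _)
    (Finset.pairwise_sort _ _)
  refine (List.subperm_of_subset (Finset.sort_nodup _ _) fun x hx => ?_)
  rw [Finset.mem_sort] at hx ⊢
  exact h hx

end Combinatorics

/-! ### The flag of flats attached to a set without broken circuits -/

section Flag

variable {S : Type u} {M : Matroid S}

theorem exists_circuits_of_isCircuit [Finite S] {C : Set S} (hC : M.IsCircuit C) :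
    ∃ D ∈ circuits M, (D : Set S) = C :=
  ⟨C.toFinite.toFinset, by simpa [circuits] using hC, by simp⟩

theorem empty_notMem_circuits : ∅ ∉ circuits M := by
  intro h
  have : M.IsCircuit ((∅ : Finset S) : Set S) := h
  simpa using this.nonempty

variable [LinearOrder S]

theorem NoBroken.indep [Finite S] (hE : M.E = Set.univ) {J : Finset S} (hJ : NoBroken (circuits M) J) :
    M.Indep (J : Set S) := by
  by_contra h
  rw [Matroid.not_indep_iff (by rw [hE]; exact Set.subset_univ _)] at h
  obtain ⟨C, hCJ, hC⟩ := h.exists_isCircuit_subset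
  obtain ⟨D, hD, rfl⟩ := exists_circuits_of_isCircuit hC
  exact hJ D hD ((eraseMin_subset D).trans (Finset.coe_subset.1 hCJ))

variable (M) in
/-- The largest `j ∈ J` such that `s` lies in the closure of `{x ∈ J | j ≤ x}`. -/
def level (J : Finset S) (s : S) : WithBot S :=
  haveI := Classical.decPred fun j => s ∈ M.closure {x | x ∈ J ∧ j ≤ x}
  ({j ∈ J | s ∈ M.closure {x | x ∈ J ∧ j ≤ x}} : Finset S).max

theorem level_mem {J : Finset S} {s j : S} (h : level M J s = j) :
    j ∈ J ∧ s ∈ M.closure {x | x ∈ J ∧ j ≤ x} := by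
  classical
  have := Finset.mem_of_max h
  simpa using this

theorem le_level {J : Finset S} {s j : S} (hj : j ∈ J) (h : s ∈ M.closure {x | x ∈ J ∧ j ≤ x}) :
    (j : WithBot S) ≤ level M J s := by
  classical
  exact Finset.le_max (Finset.mem_filter.2 ⟨hj, h⟩)

/-- Looplessness covers the case where no element of J exceeds m: the closure of ∅ must then be
empty. -/
theorem lt_level_iff (hloop : M.Loopless) {J : Finset S} {s : S} {m : WithBot S} :
    m < level M J s ↔ s ∈ M.closure {x | x ∈ J ∧ m < x} := by
  constructor
  · intro h
    obtain ⟨j, hj⟩ := WithBot.ne_bot_iff_exists.1 (ne_bot_of_gt h)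
    obtain ⟨-, h2⟩ := level_mem hj.symm
    rw [← hj] at h
    refine M.closure_subset_closure ?_ h2
    exact fun x hx => ⟨hx.1, h.trans_le (WithBot.coe_le_coe.2 hx.2)⟩
  · intro h
    classical
    have hne : ({x ∈ J | m < x} : Finset S).Nonempty := by
      rw [Finset.nonempty_iff_ne_empty]
      intro h0
      have h1 : {x | x ∈ J ∧ m < x} = (∅ : Set S) := by
        ext x
        have := Finset.ext_iff.1 h0 x
        simpa using this
      rw [h1, ← Matroid.loops, M.loops_eq_empty] at h
      exact h
    obtain ⟨hj, hmj⟩ := Finset.mem_filter.1 (Finset.min'_mem _ hne)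
    refine hmj.trans_le (le_level hj (M.closure_subset_closure ?_ h))
    exact fun x hx => ⟨hx.1, Finset.min'_le _ _ (Finset.mem_filter.2 ⟨hx.1, hx.2⟩)⟩

/-- The minimal level on C is attained twice. If only c attained it, the rest of C, and with it c,
would lie in the flat of strictly higher level. -/
theorem exists_level_eq (hloop : M.Loopless) (J : Finset S) {C : Finset S} (hC : C ∈ circuits M) :
    ∃ a ∈ C, ∃ b ∈ C, a < b ∧ level M J a = level M J b := by
  have hC : M.IsCircuit (C : Set S) := hC
  obtain ⟨c, hc, hmin⟩ := Finset.exists_min_image C (level M J) (by simpa using hC.nonempty)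
  by_cases h : ∃ b ∈ C, b ≠ c ∧ level M J b = level M J c
  · obtain ⟨b, hb, hbc, he⟩ := h
    rcases lt_or_gt_of_ne hbc with h' | h'
    · exact ⟨b, hb, c, hc, h', he⟩
    · exact ⟨c, hc, b, hb, h', he.symm⟩
  · push Not at h
    have h1 : (C : Set S) \ {c} ⊆ M.closure {x | x ∈ J ∧ level M J c < x} := by
      intro x hx
      rw [← lt_level_iff hloop]
      exact lt_of_le_of_ne (hmin x hx.1) (h x hx.1 hx.2).symm
    have h2 := M.closure_subset_closure_of_subset_closure h1
      (hC.mem_closure_sdiff_singleton_of_mem hc)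
    rw [← lt_level_iff hloop] at h2
    exact absurd h2 (lt_irrefl _)

theorem level_self [Finite S] (hE : M.E = Set.univ) {J : Finset S} (hJ : NoBroken (circuits M) J) {j : S}
    (hj : j ∈ J) : level M J j = j := by
  have hind := hJ.indep hE
  have h1 := le_level hj (M.subset_closure {x | x ∈ J ∧ j ≤ x}
    (by rw [hE]; exact Set.subset_univ _) ⟨hj, le_rfl⟩)
  obtain ⟨k, hk⟩ := WithBot.ne_bot_iff_exists.1 (ne_bot_of_le_ne_bot WithBot.coe_ne_bot h1)
  rw [← hk, WithBot.coe_le_coe] at h1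
  rcases h1.eq_or_lt with rfl | h1
  · exact hk.symm
  · exfalso
    obtain ⟨-, h2⟩ := level_mem hk.symm
    refine hind.notMem_closure_sdiff_of_mem (Finset.mem_coe.2 hj) (M.closure_subset_closure ?_ h2)
    exact fun x hx => ⟨hx.1, fun e => (h1.trans_le hx.2).ne (e : x = j).symm⟩

/-- For j ∈ J \ K, the elements of K of level at least j span the flat of {x ∈ J | j ≤ x}, so j
closes a circuit D with them. If j = min D, then K contains the broken circuit D'. Otherwise some y
< j in D lies in that flat and closes a circuit whose broken circuit is in J. -/
theorem eq_of_level_injOn [Finite S] (hE : M.E = Set.univ) {J K : Finset S}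
    (hJ : NoBroken (circuits M) J) (hK : NoBroken (circuits M) K) (hcard : K.card = J.card)
    (hinj : Set.InjOn (level M J) K) (hbot : ∀ x ∈ K, level M J x ≠ ⊥) : K = J := by
  classical
  refine (Finset.eq_of_subset_of_card_le (fun j hj => ?_) hcard.le).symm
  by_contra hjK
  have hsub : ∀ X : Set S, X ⊆ M.E := fun X => hE ▸ Set.subset_univ X
  have himage : K.image (level M J) = J.image (↑· : S → WithBot S) := by
    refine Finset.eq_of_subset_of_card_le (fun x hx => ?_) ?_
    · obtain ⟨s, hs, rfl⟩ := Finset.mem_image.1 hx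
      obtain ⟨j, hj⟩ := WithBot.ne_bot_iff_exists.1 (hbot s hs)
      rw [← hj]
      exact Finset.mem_image_of_mem _ (level_mem hj.symm).1
    · rw [Finset.card_image_of_injOn hinj, hcard]
      exact Finset.card_image_le
  set Jj : Finset S := {x ∈ J | j ≤ x} with hJj
  set Kj : Finset S := {x ∈ K | (j : WithBot S) ≤ level M J x} with hKj
  have hJset : {x | x ∈ J ∧ j ≤ x} = (Jj : Set S) := by simp [hJj]
  have hKcl : (Kj : Set S) ⊆ M.closure Jj := by
    intro x hx
    obtain ⟨hx, hle⟩ := Finset.mem_filter.1 hx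
    obtain ⟨k, hk⟩ := WithBot.ne_bot_iff_exists.1 (hbot x hx)
    rw [← hk, WithBot.coe_le_coe] at hle
    rw [← hJset]
    refine M.closure_subset_closure ?_ (level_mem hk.symm).2
    exact fun y hy => ⟨hy.1, hle.trans hy.2⟩
  -- Each element of J is the level of some element of K, by `himage`.
  have hle : Jj.card ≤ Kj.card := by
    refine le_trans ?_ (Finset.card_image_le (s := Kj) (f := level M J))
    rw [← Finset.card_image_of_injective Jj (WithBot.coe_injective)]
    refine Finset.card_le_card fun x hx => ?_
    obtain ⟨i, hi, rfl⟩ := Finset.mem_image.1 hx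
    obtain ⟨hi, hji⟩ := Finset.mem_filter.1 hi
    obtain ⟨s, hs, hsi⟩ := Finset.mem_image.1 (himage ▸ Finset.mem_image_of_mem _ hi)
    exact Finset.mem_image.2 ⟨s, Finset.mem_filter.2 ⟨hs, hsi ▸ WithBot.coe_le_coe.2 hji⟩, hsi⟩
  have hKind : M.Indep (Kj : Set S) :=
    (hK.indep hE).subset (Finset.coe_subset.2 (Finset.filter_subset _ _))
  have hJind : M.Indep (Jj : Set S) :=
    (hJ.indep hE).subset (Finset.coe_subset.2 (Finset.filter_subset _ _))
  have hjKj : j ∉ Kj := fun h => hjK (Finset.mem_filter.1 h).1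
  have hjJ : j ∈ M.closure (Jj : Set S) :=
    M.subset_closure _ (hsub _) (by simp [hJj, hj])
  have hjcl : j ∈ M.closure (Kj : Set S) := by
    -- Otherwise Kj ∪ {j} would be independent in a flat of rank #Jj and have more than #Jj
    -- elements.
    by_contra h
    have h1 := (hKind.notMem_closure_iff_of_notMem (by simpa using hjKj) (by simp [hE])).1 h
    have h2 := h1.encard_le_eRk_of_subset (Set.insert_subset hjJ hKcl)
    rw [M.eRk_closure_eq, hJind.eRk_eq_encard, ← Finset.coe_insert, Set.encard_coe_eq_coe_finsetCard,
      Set.encard_coe_eq_coe_finsetCard, Finset.card_insert_of_notMem hjKj] at h2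
    have h2 : Kj.card + 1 ≤ Jj.card := by exact_mod_cast h2
    omega
  obtain ⟨C, hCsub, hC, hjC⟩ := (Matroid.mem_closure_iff_exists_isCircuit
    (by simpa using hjKj)).1 hjcl
  obtain ⟨D, hD, rfl⟩ := exists_circuits_of_isCircuit hC
  have hDK : ∀ y ∈ D, y ≠ j → y ∈ Kj := fun y hy hyj => by
    have := hCsub hy
    simpa [hyj] using this
  by_cases hmin : ∃ y ∈ D, y < j
  · obtain ⟨y, hy, hyj⟩ := hmin
    have hycl := hKcl (hDK y hy hyj.ne)
    have hyJ : y ∉ Jj := fun h => (Finset.mem_filter.1 h).2.not_gt hyj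
    obtain ⟨C', hC'sub, hC', hyC'⟩ := (Matroid.mem_closure_iff_exists_isCircuit
      (by simpa using hyJ)).1 hycl
    obtain ⟨D', hD', rfl⟩ := exists_circuits_of_isCircuit hC'
    refine hJ D' hD' fun x hx => ?_
    obtain ⟨hx, i, hi, hix⟩ := Finset.mem_filter.1 hx
    have hcase : ∀ z ∈ D', z = y ∨ z ∈ Jj := fun z hz => by
      have := hC'sub hz
      simpa using this
    rcases hcase x hx with rfl | h
    · rcases hcase i hi with rfl | h
      · exact absurd hix (lt_irrefl _)
      · exact absurd (hix.trans hyj) (Finset.mem_filter.1 h).2.not_gt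
    · exact (Finset.mem_filter.1 h).1
  · push Not at hmin
    refine hK D hD fun x hx => ?_
    obtain ⟨hx, i, hi, hix⟩ := Finset.mem_filter.1 hx
    exact (Finset.mem_filter.1 (hDK x hx ((hmin i hi).trans_lt hix).ne')).1

end Flag

/-! ### Linear independence of the monomials of sets without broken circuits -/

section Fock

variable {R : Type v} [CommRing R] {V : Type w} [AddCommGroup V] [Module R V]

/-- The operator `x ↦ a ∧ x + q (d ⌋ x)` on the exterior algebra. -/
def wedgeContract (q : R) (d : Module.Dual R V) (a : V) : Module.End R (ExteriorAlgebra R V) :=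
  LinearMap.mulLeft R (ExteriorAlgebra.ι R a) +
    q • CliffordAlgebra.contractLeft (Q := (0 : QuadraticForm R V)) d

theorem wedgeContract_apply (q : R) (d : Module.Dual R V) (a : V) (x : ExteriorAlgebra R V) :
    wedgeContract q d a x = ExteriorAlgebra.ι R a * x +
      q • CliffordAlgebra.contractLeft (Q := (0 : QuadraticForm R V)) d x := rfl

/-- Wedging with a and contracting with d both square to zero, and their anticommutator is the
scalar d(a) = 1. -/
theorem cliffordRel_wedgeContract {S : Type u} (q : R) (d : Module.Dual R V) (f : S → V)
    (h : ∀ s, d (f s) = 1) : CliffordRel q fun s => wedgeContract q d (f s) := by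
  constructor
  · intro s
    refine LinearMap.ext fun x => ?_
    simp only [Module.End.mul_apply, wedgeContract_apply, map_add, map_smul,
      Module.algebraMap_end_apply]
    rw [ExteriorAlgebra.ι, CliffordAlgebra.contractLeft_ι_mul,
      CliffordAlgebra.contractLeft_contractLeft, h, ← mul_assoc, CliffordAlgebra.ι_sq_scalar]
    simp [smul_sub]
  · intro r s
    refine LinearMap.ext fun x => ?_
    have h0 : ExteriorAlgebra.ι R (f r) * ExteriorAlgebra.ι R (f s) =
        -(ExteriorAlgebra.ι R (f s) * ExteriorAlgebra.ι R (f r)) :=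
      eq_neg_of_add_eq_zero_left (ExteriorAlgebra.ι_add_mul_swap _ _)
    rw [ExteriorAlgebra.ι] at h0
    simp only [LinearMap.add_apply, Module.End.mul_apply, wedgeContract_apply, map_add, map_smul,
      Module.algebraMap_end_apply]
    rw [ExteriorAlgebra.ι, CliffordAlgebra.contractLeft_ι_mul, CliffordAlgebra.contractLeft_ι_mul,
      CliffordAlgebra.contractLeft_contractLeft, h, h, ← mul_assoc, ← mul_assoc, h0]
    simp only [smul_sub, smul_zero, one_smul, two_mul, add_smul, add_zero, neg_mul]
    abel

variable (R V) in
/-- The span of the products of fewer than `n` vectors in the exterior algebra. -/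
def lowPart (n : ℕ) : Submodule R (ExteriorAlgebra R V) :=
  Submodule.span R {x | ∃ l : List V, l.length < n ∧ x = (l.map (ExteriorAlgebra.ι R)).prod}

theorem lowPart_mono {m n : ℕ} (h : m ≤ n) : lowPart R V m ≤ lowPart R V n :=
  Submodule.span_mono fun _ ⟨l, hl, e⟩ => ⟨l, hl.trans_le h, e⟩

theorem ι_mul_mem_lowPart (a : V) {n : ℕ} {x : ExteriorAlgebra R V} (hx : x ∈ lowPart R V n) :
    ExteriorAlgebra.ι R a * x ∈ lowPart R V (n + 1) := by
  induction hx using Submodule.span_induction with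
  | mem x h =>
    obtain ⟨l, hl, rfl⟩ := h
    exact Submodule.subset_span ⟨a :: l, by simpa using hl, by simp⟩
  | zero => simp
  | add x y _ _ hx hy => rw [mul_add]; exact add_mem hx hy
  | smul c x _ hx => rw [mul_smul_comm]; exact Submodule.smul_mem _ _ hx

theorem contractLeft_prod_mem (d : Module.Dual R V) (l : List V) :
    CliffordAlgebra.contractLeft (Q := (0 : QuadraticForm R V)) d
      (l.map (ExteriorAlgebra.ι R)).prod ∈ lowPart R V l.length := by
  induction l with
  | nil => simp
  | cons a l ih =>
    rw [List.map_cons, List.prod_cons, ExteriorAlgebra.ι, CliffordAlgebra.contractLeft_ι_mul]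
    refine sub_mem (Submodule.smul_mem _ _ (Submodule.subset_span ⟨l, by simp, rfl⟩)) ?_
    exact ι_mul_mem_lowPart a ih

theorem contractLeft_mem_lowPart (d : Module.Dual R V) {n : ℕ} {x : ExteriorAlgebra R V}
    (hx : x ∈ lowPart R V n) :
    CliffordAlgebra.contractLeft (Q := (0 : QuadraticForm R V)) d x ∈ lowPart R V n := by
  induction hx using Submodule.span_induction with
  | mem x h =>
    obtain ⟨l, hl, rfl⟩ := h
    exact lowPart_mono hl.le (contractLeft_prod_mem d l)
  | zero => simp
  | add x y _ _ hx hy => rw [map_add]; exact add_mem hx hy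
  | smul c x _ hx => rw [map_smul]; exact Submodule.smul_mem _ _ hx

/-- Contractions lower the degree, so the top-degree part of the product applied to 1 is the plain
wedge product. A form of degree #J therefore sees no trace of q. -/
theorem prod_wedgeContract_one (q : R) (d : Module.Dual R V) (l : List V) :
    (l.map (wedgeContract q d)).prod 1 - (l.map (ExteriorAlgebra.ι R)).prod ∈
      lowPart R V l.length := by
  induction l with
  | nil => simp
  | cons a l ih =>
    rw [List.map_cons, List.prod_cons, List.map_cons, List.prod_cons, Module.End.mul_apply,
      wedgeContract_apply, add_sub_right_comm, ← mul_sub]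
    refine add_mem (ι_mul_mem_lowPart a ih) (Submodule.smul_mem _ _ ?_)
    rw [← sub_add_cancel ((l.map (wedgeContract q d)).prod 1)
      (l.map (ExteriorAlgebra.ι R)).prod, map_add]
    refine lowPart_mono (Nat.le_succ _) (add_mem (contractLeft_mem_lowPart d ih) ?_)
    exact contractLeft_prod_mem d l

/-- The linear form on the exterior algebra that is given by an alternating form in degree `k`
and vanishes in all other degrees. -/
def alternatingForm {k : ℕ} (f : V [⋀^Fin k]→ₗ[R] R) : ExteriorAlgebra R V →ₗ[R] R :=
  ExteriorAlgebra.liftAlternating (Pi.single k f)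

theorem prod_map_ι (l : List V) :
    (l.map (ExteriorAlgebra.ι R)).prod = ExteriorAlgebra.ιMulti R l.length l.get := by
  rw [ExteriorAlgebra.ιMulti_apply]
  congr 1
  conv_lhs => rw [← List.ofFn_get l, List.map_ofFn]
  rfl

theorem alternatingForm_prod {k : ℕ} (f : V [⋀^Fin k]→ₗ[R] R) (l : List V) (h : l.length = k) :
    alternatingForm f (l.map (ExteriorAlgebra.ι R)).prod = f fun i => l.get (i.cast h.symm) := by
  subst h
  rw [prod_map_ι, alternatingForm, ExteriorAlgebra.liftAlternating_apply_ιMulti, Pi.single_eq_same]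
  rfl

theorem alternatingForm_lowPart {k : ℕ} (f : V [⋀^Fin k]→ₗ[R] R) {x : ExteriorAlgebra R V}
    (hx : x ∈ lowPart R V k) : alternatingForm f x = 0 := by
  induction hx using Submodule.span_induction with
  | mem x h =>
    obtain ⟨l, hl, rfl⟩ := h
    rw [prod_map_ι, alternatingForm, ExteriorAlgebra.liftAlternating_apply_ιMulti,
      Pi.single_eq_of_ne hl.ne]
    rfl
  | zero => simp
  | add x y _ _ hx hy => rw [map_add, hx, hy, add_zero]
  | smul c x _ hx => rw [map_smul, hx, smul_zero]

end Fock

/-! ### Linear forms dual to the nbc monomials -/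

section Independence

variable {R : Type v} [CommRing R] {S : Type u} [LinearOrder S]

theorem defIdeal_le_ker {A : Type w} [Ring A] [Algebra R A] {q : R} {t : S → A}
    (h : CliffordRel q t) {𝓜 : Set (Finset S)}
    (h𝓜 : ∀ C ∈ 𝓜, ∃ a ∈ C, ∃ b ∈ C, a < b ∧ t a = t b) :
    defIdeal q 𝓜 ≤ TwoSidedIdeal.ker (FreeAlgebra.lift R t) := by
  rw [defIdeal, TwoSidedIdeal.span_le]
  have hvar : ∀ s, FreeAlgebra.lift R t (tVar R s) = t s := fun s => by simp [tVar]
  rintro f ((⟨s, rfl⟩ | ⟨r, s, -, rfl⟩) | ⟨C, hC, rfl⟩) <;>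
    rw [SetLike.mem_coe, TwoSidedIdeal.mem_ker]
  · rw [map_sub, map_pow, hvar, pow_two, h.sq, AlgHom.commutes, sub_self]
  · rw [map_sub, map_add, map_mul, map_mul, hvar, hvar, h.anti, AlgHom.commutes, sub_self]
  · obtain ⟨a, ha, b, hb, hab, he⟩ := h𝓜 C hC
    rw [(tMinus_eq_minusPlus q C).1, (map_minusPlus _ q _ _).1]
    simp only [hvar]
    refine h.minus_eq_zero ?_ he
    have : ({a, b} : Finset S) ⊆ C := by
      intro x hx
      rcases Finset.mem_insert.1 hx with rfl | hx
      · exact ha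
      · rwa [Finset.mem_singleton.1 hx]
    convert sort_sublist_sort this
    rw [Finset.sort_insert _ (by simpa using hab.le) (by simpa using hab.ne), Finset.sort_singleton]

variable [Finite S] {M : Matroid S}

/-- The form is the determinant of the J-coordinates, evaluated on the action on 1. On t_K with #K =
#J it is the determinant of the matrix recording which element of J is the level of each element of
K: the identity for K = J. For other nbc K, `eq_of_level_injOn` yields a zero row or two equal rows.
If #K < #J, the degree is too low. -/
theorem exists_dual_form (hE : M.E = Set.univ) (hloop : M.Loopless) (q : R) {J : Finset S}
    (hJ : NoBroken (circuits M) J) :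
    ∃ φ : FreeAlgebra R S →ₗ[R] R, (∀ x ∈ defIdeal q (circuits M), φ x = 0) ∧
      φ (tMon R J) = 1 ∧
      ∀ K, NoBroken (circuits M) K → K.card ≤ J.card → K ≠ J → φ (tMon R K) = 0 := by
  classical
  -- The first component is the unit vector at the level of s, or 0 if the level is ⊥. The second
  -- component is there only to make d(f s) = 1.
  let f : S → (S → R) × R := fun s =>
    (fun x => if level M J s = (x : WithBot S) then 1 else 0, 1)
  let d : Module.Dual R ((S → R) × R) := LinearMap.snd R (S → R) R
  let k := J.card
  let det : ((S → R) × R) [⋀^Fin k]→ₗ[R] R :=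
    (Matrix.detRowAlternating (n := Fin k) (R := R)).compLinearMap
      (LinearMap.funLeft R R (J.orderEmbOfFin rfl) ∘ₗ LinearMap.fst R (S → R) R)
  have hrel : CliffordRel q fun s => wedgeContract q d (f s) :=
    cliffordRel_wedgeContract q d f fun _ => rfl
  let Φ := FreeAlgebra.lift R fun s => wedgeContract q d (f s)
  have hΦ : ∀ K : Finset S, Φ (tMon R K) 1 -
      (((K.sort (· ≤ ·)).map f).map (ExteriorAlgebra.ι R)).prod ∈
        lowPart R ((S → R) × R) K.card := by
    intro K
    have := prod_wedgeContract_one q d ((K.sort (· ≤ ·)).map f)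
    rw [List.length_map, Finset.length_sort] at this
    convert this using 3
    rw [tMon, map_list_prod, List.map_map, List.map_map]
    congr 2
    ext1 s
    simp [Φ, tVar]
  have hval : ∀ K : Finset S, ∀ h : K.card = k, alternatingForm det (Φ (tMon R K) 1) =
      Matrix.det (Matrix.of fun i c : Fin k => if level M J (K.orderEmbOfFin h i) =
        (J.orderEmbOfFin rfl c : S) then (1 : R) else 0) := by
    intro K h
    have h1 := alternatingForm_lowPart det (h ▸ hΦ K)
    rw [map_sub, sub_eq_zero] at h1
    rw [h1, alternatingForm_prod _ _ (by simpa using h)]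
    simp only [det, AlternatingMap.compLinearMap_apply]
    change Matrix.det _ = _
    congr 1
    ext i c
    simp [f, LinearMap.funLeft, Finset.orderEmbOfFin_apply]
    rfl
  refine ⟨alternatingForm det ∘ₗ LinearMap.applyₗ 1 ∘ₗ Φ.toLinearMap, ?_, ?_, ?_⟩
  · intro x hx
    have h0 : ∀ C ∈ circuits M, ∃ a ∈ C, ∃ b ∈ C, a < b ∧
        wedgeContract q d (f a) = wedgeContract q d (f b) := by
      intro C hC
      obtain ⟨a, ha, b, hb, hab, he⟩ := exists_level_eq hloop J hC
      exact ⟨a, ha, b, hb, hab, by simp only [f, he]⟩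
    have := defIdeal_le_ker hrel h0 hx
    rw [TwoSidedIdeal.mem_ker] at this
    have hx : Φ x = 0 := this
    simp [hx]
  · refine (hval J rfl).trans ?_
    convert (Matrix.det_one : (1 : Matrix (Fin k) (Fin k) R).det = 1)
    ext i c
    rw [Matrix.of_apply, level_self hE hJ (Finset.orderEmbOfFin_mem _ _ _), Matrix.one_apply]
    simp
  · intro K hK hcard hne
    rcases hcard.eq_or_lt with h | h
    · refine (hval K h).trans ?_
      have hsurj : ∀ x ∈ K, ∃ i, K.orderEmbOfFin h i = x := fun x hx => by
        have := Finset.range_orderEmbOfFin K h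
        rwa [← Finset.mem_coe, ← this] at hx
      by_cases hbot : ∀ x ∈ K, level M J x ≠ ⊥
      · have hinj : ¬ Set.InjOn (level M J) K := fun hinj =>
          hne (eq_of_level_injOn hE hJ hK h hinj hbot)
        simp only [Set.InjOn, not_forall] at hinj
        obtain ⟨x, hx, y, hy, hxy, hxy'⟩ := hinj
        obtain ⟨i, rfl⟩ := hsurj x hx
        obtain ⟨j, rfl⟩ := hsurj y hy
        refine Matrix.det_zero_of_row_eq (i := i) (j := j) (fun e => hxy' (e ▸ rfl)) ?_
        ext c
        simp [hxy]
      · push Not at hbot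
        obtain ⟨x, hx, hxb⟩ := hbot
        obtain ⟨i, rfl⟩ := hsurj x hx
        refine Matrix.det_eq_zero_of_row_eq_zero i fun c => ?_
        simp [hxb]
    · have h1 := alternatingForm_lowPart det (lowPart_mono h.le (hΦ K))
      rw [map_sub, sub_eq_zero] at h1
      refine h1.trans (alternatingForm_lowPart det (Submodule.subset_span ⟨_, ?_, rfl⟩))
      simpa using h

theorem linearIndependent_mk_tMon (hE : M.E = Set.univ) (hloop : M.Loopless) (q : R) :
    LinearIndependent R fun K : {K : Finset S // NoBroken (circuits M) K} =>
      OSq.mk q (circuits M) (tMon R K.1) := by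
  classical
  rw [linearIndependent_iff']
  intro s g hg i hi
  by_contra hgi
  -- The dual form of J controls only sets of at most #J elements, so J is taken of maximal
  -- cardinality in the relation.
  obtain ⟨J, hJ, hmax⟩ := Finset.exists_max_image (s.filter fun K => g K ≠ 0)
    (fun K => K.1.card) ⟨i, Finset.mem_filter.2 ⟨hi, hgi⟩⟩
  obtain ⟨hJs, hgJ⟩ := Finset.mem_filter.1 hJ
  obtain ⟨φ, hφ, h1, h2⟩ := exists_dual_form hE hloop q J.2
  have hmem : ∑ K ∈ s, g K • tMon R K.1 ∈ defIdeal q (circuits M) := by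
    rw [← TwoSidedIdeal.ker_ringCon_mk' (defIdeal q (circuits M)), TwoSidedIdeal.mem_ker, map_sum]
    exact hg
  have h3 := hφ _ hmem
  rw [map_sum, Finset.sum_eq_single_of_mem J hJs] at h3
  · rw [map_smul, h1, smul_eq_mul, mul_one] at h3
    exact hgJ h3
  · intro K hKs hKJ
    rw [map_smul]
    by_cases hgK : g K = 0
    · rw [hgK, zero_smul]
    · rw [h2 K.1 K.2 (hmax K (Finset.mem_filter.2 ⟨hKs, hgK⟩)) fun e => hKJ (Subtype.ext e),
        smul_zero]

end Independence

/-! ### The degree lexicographic order on words -/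

section Words

theorem WordLT.trans {α : Type u} [LinearOrder α] {a b c : List α} (h₁ : WordLT a b)
    (h₂ : WordLT b c) : WordLT a c := by
  rw [WordLT, List.shortlex_def] at *
  rcases h₁ with h₁ | h₁ <;> rcases h₂ with h₂ | h₂
  · exact Or.inl (h₁.trans h₂)
  · exact Or.inl (h₁.trans_eq h₂.1)
  · exact Or.inl (h₁.1.trans_lt h₂)
  · exact Or.inr ⟨h₁.1.trans h₂.1, List.lex_trans (fun h h' => lt_trans h h') h₁.2 h₂.2⟩

theorem WordLT.length_le {α : Type u} [LT α] {a b : List α} (h : WordLT a b) :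
    a.length ≤ b.length := by
  rw [WordLT, List.shortlex_def] at h
  rcases h with h | h
  · exact h.le
  · exact h.1.le

theorem WordLT.irrefl {α : Type u} [LinearOrder α] (a : List α) : ¬ WordLT a a := by
  intro h
  rw [WordLT, List.shortlex_def] at h
  rcases h with h | ⟨-, h⟩
  · exact lt_irrefl _ h
  · induction a with
    | nil => cases h
    | cons x a ih =>
      cases h with
      | rel h => exact lt_irrefl _ h
      | cons h => exact ih h

theorem lex_append {α : Type u} {r : α → α → Prop} {a b : List α} (h : List.Lex r a b)
    (hlen : a.length = b.length) (c : List α) : List.Lex r (a ++ c) (b ++ c) := by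
  induction h with
  | nil => simp at hlen
  | cons _ ih => exact .cons (ih (by simpa using hlen))
  | rel h => exact .rel h

theorem WordLT.append {α : Type u} [LT α] {a b : List α} (h : WordLT a b) (c d : List α) :
    WordLT (c ++ a ++ d) (c ++ b ++ d) := by
  rw [List.append_assoc, List.append_assoc]
  refine List.Shortlex.append_left ?_ c
  rcases List.shortlex_def.1 h with h | h
  · exact .of_length_lt (by simpa using h)
  · exact .of_lex (by simp [h.1]) (lex_append h.2 h.1 d)

theorem WordLT.wf (α : Type u) [LinearOrder α] [Finite α] :
    WellFounded (WordLT : List α → List α → Prop) :=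
  List.Shortlex.wf (IsWellFounded.wf : WellFounded ((· < ·) : α → α → Prop))

end Words

/-! ### Leading words of the generators -/

section Leading

variable {R : Type v} [CommRing R] {S : Type u}

/-- The word `w`, read in the free algebra. -/
def wordMon (R : Type v) [CommRing R] {S : Type u} (w : List S) : FreeAlgebra R S :=
  (w.map (tVar R)).prod

theorem wordMon_append (a b : List S) : wordMon R (a ++ b) = wordMon R a * wordMon R b := by
  simp [wordMon]

theorem wordMon_cons (a : S) (b : List S) : wordMon R (a :: b) = tVar R a * wordMon R b := by
  simp [wordMon]

theorem basisFreeMonoid_apply (w : FreeMonoid S) :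
    FreeAlgebra.basisFreeMonoid R S w = wordMon R w.toList := by
  have : FreeAlgebra.basisFreeMonoid R S w = FreeMonoid.lift (FreeAlgebra.ι R) w := by
    simp [FreeAlgebra.basisFreeMonoid, FreeAlgebra.equivMonoidAlgebraFreeMonoid]
  rw [this, FreeMonoid.lift_apply]
  rfl

variable (Q : Type w) [CommRing Q] [Algebra Q R]

/-- The `Q`-span of the elements `x^(n-|v|) v`, for the words `v` in a set `W`. -/
def homogSpan (x : R) (n : ℕ) (W : Set (List S)) : Submodule Q (FreeAlgebra R S) :=
  Submodule.span Q ((fun v => x ^ (n - v.length) • wordMon R v) '' W)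

variable {Q}

theorem homogSpan_mono (x : R) (n : ℕ) {W W' : Set (List S)} (h : W ⊆ W') :
    homogSpan Q x n W ≤ homogSpan Q x n W' :=
  Submodule.span_mono (Set.image_mono h)

theorem smul_homogSpan {x : R} {n m k : ℕ} {W : Set (List S)} (h : ∀ v ∈ W, v.length ≤ n)
    (hk : m = k + n) {f : FreeAlgebra R S} (hf : f ∈ homogSpan Q x n W) :
    x ^ k • f ∈ homogSpan Q x m W := by
  induction hf using Submodule.span_induction with
  | mem f h' =>
    obtain ⟨v, hv, rfl⟩ := h'
    refine Submodule.subset_span ⟨v, hv, ?_⟩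
    have := h v hv
    simp only [smul_smul, ← pow_add]
    congr 2
    omega
  | zero => simp
  | add f g _ _ hf hg => rw [smul_add]; exact add_mem hf hg
  | smul c f _ hf => rw [smul_comm]; exact Submodule.smul_mem _ _ hf

theorem wordMon_mul_homogSpan {x : R} {n m : ℕ} {W W' : Set (List S)} (a b : List S)
    (hW : ∀ v ∈ W, a ++ v ++ b ∈ W')
    (hm : m = a.length + n + b.length) {f : FreeAlgebra R S} (hf : f ∈ homogSpan Q x n W) :
    wordMon R a * f * wordMon R b ∈ homogSpan Q x m W' := by
  induction hf using Submodule.span_induction with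
  | mem f h' =>
    obtain ⟨v, hv, rfl⟩ := h'
    refine Submodule.subset_span ⟨_, hW v hv, ?_⟩
    simp only [mul_smul_comm, smul_mul_assoc, wordMon_append]
    congr 2
    simp only [List.length_append]
    omega
  | zero => simp
  | add f g _ _ hf hg => rw [mul_add, add_mul]; exact add_mem hf hg
  | smul c f _ hf =>
    rw [mul_smul_comm, smul_mul_assoc]; exact Submodule.smul_mem _ _ hf

theorem tVar_mul_homogSpan {x : R} {n m : ℕ} {W W' : Set (List S)} (a : S)
    (hW : ∀ v ∈ W, a :: v ∈ W') (hm : m = n + 1) {f : FreeAlgebra R S}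
    (hf : f ∈ homogSpan Q x n W) : tVar R a * f ∈ homogSpan Q x m W' := by
  have := wordMon_mul_homogSpan (m := m) (W' := W') [a] [] (by simpa using hW)
    (by simp; omega) hf
  simpa [wordMon] using this

theorem wordMon_mem_homogSpan {x : R} {n : ℕ} {W : Set (List S)} {v : List S} (hv : v ∈ W)
    (hn : v.length = n) : wordMon R v ∈ homogSpan Q x n W :=
  Submodule.subset_span ⟨v, hv, by simp [hn]⟩

/-- With x of degree one, t⁻_l and t⁺_l are homogeneous of degrees #l - 1 and #l, and l is the only
word of full length in t⁺_l. -/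
theorem minusPlus_mem (x : R) (l : List S) :
    (minusPlus (x ^ 2) (tVar R) l).1 ∈
        homogSpan Q x (l.length - 1) {v : List S | v.length < l.length} ∧
      (minusPlus (x ^ 2) (tVar R) l).2 - wordMon R l ∈
        homogSpan Q x l.length {v : List S | v.length < l.length} := by
  induction l with
  | nil => simp [minusPlus, wordMon]
  | cons a l ih =>
    have hlt : {v : List S | v.length < l.length} ⊆ {v : List S | v.length < (a :: l).length} :=
      fun v hv => by simp only [Set.mem_ofPred_eq, List.length_cons] at hv ⊢; omega
    have hone := ih.1
    constructor
    · have h1 : (minusPlus (x ^ 2) (tVar R) (a :: l)).1 =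
          ((minusPlus (x ^ 2) (tVar R) l).2 - wordMon R l) + wordMon R l -
            tVar R a * (minusPlus (x ^ 2) (tVar R) l).1 := by
        simp [minusPlus]
      rw [h1]
      refine sub_mem (add_mem (homogSpan_mono x _ hlt ih.2)
        (wordMon_mem_homogSpan (by simp) (by simp))) ?_
      -- For the empty word #l - 1 truncates to 0 and the degree count fails, but there t⁻ = 0.
      cases l with
      | nil => simp [minusPlus]
      | cons b l =>
        exact tVar_mul_homogSpan a (fun v hv => by simpa using hv) (by simp) hone
    · have h1 : (minusPlus (x ^ 2) (tVar R) (a :: l)).2 - wordMon R (a :: l) =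
          tVar R a * ((minusPlus (x ^ 2) (tVar R) l).2 - wordMon R l) -
            x ^ 2 • (minusPlus (x ^ 2) (tVar R) l).1 := by
        rw [wordMon_cons]
        simp only [minusPlus]
        noncomm_ring
      rw [h1]
      refine sub_mem (tVar_mul_homogSpan a (fun v hv => by simpa using hv) (by simp) ih.2) ?_
      cases l with
      | nil => simp [minusPlus]
      | cons b l =>
        refine homogSpan_mono x _ hlt (smul_homogSpan (fun v hv => ?_) ?_ hone)
        · simp only [Set.mem_ofPred_eq, List.length_cons] at hv ⊢
          omega
        · simp only [List.length_cons]
          omega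

variable [LinearOrder S]

theorem exists_sort_eq_cons {J : Finset S} (hJ : J.Nonempty) :
    ∃ a, (∀ x ∈ eraseMin J, a < x) ∧ J.sort (· ≤ ·) = a :: (eraseMin J).sort (· ≤ ·) := by
  obtain ⟨a, ha, hJa⟩ := exists_eq_insert_eraseMin hJ
  refine ⟨a, ha, ?_⟩
  conv_lhs => rw [hJa]
  exact Finset.sort_insert _ (fun b hb => (ha b hb).le) (fun h' => lt_irrefl _ (ha a h'))

variable (Q) in
/-- The element `g` is the word `w` plus a `Q`-linear combination of elements `x^(|w|-|v|) v`
with smaller words `v`. -/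
def HasLeadingWord (x : R) (w : List S) (g : FreeAlgebra R S) : Prop :=
  g - wordMon R w ∈ homogSpan Q x w.length {v | WordLT v w}

theorem hasLeadingWord_sq (x : R) (s : S) :
    HasLeadingWord Q x [s, s] (tVar R s ^ 2 - algebraMap R _ (x ^ 2)) := by
  have : tVar R s ^ 2 - algebraMap R _ (x ^ 2) - wordMon R [s, s] =
      -(x ^ 2 • wordMon R ([] : List S)) := by
    simp [wordMon, pow_two, Algebra.algebraMap_eq_smul_one]
  rw [HasLeadingWord, this]
  exact neg_mem (Submodule.subset_span ⟨[], List.Shortlex.of_length_lt (by simp), by simp⟩)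

theorem hasLeadingWord_comm (x : R) {r s : S} (h : s < r) :
    HasLeadingWord Q x [r, s]
      (tVar R r * tVar R s + tVar R s * tVar R r - algebraMap R _ (2 * x ^ 2)) := by
  have : tVar R r * tVar R s + tVar R s * tVar R r - algebraMap R _ (2 * x ^ 2) -
      wordMon R [r, s] = wordMon R [s, r] - (x ^ 2 • wordMon R ([] : List S) +
        x ^ 2 • wordMon R ([] : List S)) := by
    simp only [wordMon, Algebra.algebraMap_eq_smul_one, two_mul, List.map_cons, List.map_nil,
      List.prod_cons, List.prod_nil, mul_one, add_smul]
    abel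
  rw [HasLeadingWord, this]
  have h0 : x ^ 2 • wordMon R ([] : List S) ∈
      homogSpan Q x [r, s].length {v | WordLT v [r, s]} :=
    Submodule.subset_span ⟨[], List.Shortlex.of_length_lt (by simp), by simp⟩
  exact sub_mem (wordMon_mem_homogSpan (List.Shortlex.of_lex rfl (.rel h)) rfl) (add_mem h0 h0)

/-- In t⁻_J = t⁺_{J'} - t_a t⁻_{J'} the word J' comes from t⁺. The words of full length in the
second term start with a, which is smaller than the first letter of J'. -/
theorem hasLeadingWord_tMinus (x : R) {J : Finset S} (hJ : J.Nonempty) :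
    HasLeadingWord Q x ((eraseMin J).sort (· ≤ ·)) (tMinus (x ^ 2) J) := by
  obtain ⟨a, ha, hJa⟩ := exists_sort_eq_cons hJ
  rw [HasLeadingWord, (tMinus_eq_minusPlus _ _).1, hJa, minusPlus, sub_right_comm]
  have hal : ∀ y ∈ (eraseMin J).sort (· ≤ ·), a < y := fun y hy => ha y ((Finset.mem_sort _).1 hy)
  generalize (eraseMin J).sort (· ≤ ·) = l at hal
  obtain ⟨h1, h2⟩ := minusPlus_mem (Q := Q) x l
  refine sub_mem (homogSpan_mono x _ (fun v hv => List.Shortlex.of_length_lt hv) h2) ?_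
  cases l with
  | nil => simp [minusPlus]
  | cons b l =>
    refine tVar_mul_homogSpan a (fun v hv => ?_) (by simp) h1
    simp only [Set.mem_ofPred_eq, List.length_cons] at hv
    rcases (Nat.lt_succ_iff.1 hv).lt_or_eq with hv | hv
    · exact List.Shortlex.of_length_lt (by simpa using hv)
    · exact List.Shortlex.of_lex (by simpa using hv) (.rel (hal b (by simp)))

theorem exists_eq_sort_or_descent (w : List S) :
    (∃ K : Finset S, w = K.sort (· ≤ ·)) ∨ ∃ a r s b, w = a ++ [r, s] ++ b ∧ s ≤ r := by
  have : w.Pairwise (· < ·) ∨ ∃ a r s b, w = a ++ [r, s] ++ b ∧ s ≤ r := by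
    induction w with
    | nil => simp
    | cons x w ih =>
      rcases ih with ih | ⟨a, r, s, b, rfl, h⟩
      · cases w with
        | nil => simp
        | cons y w =>
          rcases lt_or_ge x y with h | h
          · left
            refine List.pairwise_cons.2 ⟨fun z hz => ?_, ih⟩
            rcases List.mem_cons.1 hz with rfl | hz
            · exact h
            · exact h.trans ((List.pairwise_cons.1 ih).1 z hz)
          · exact Or.inr ⟨[], x, y, w, rfl, h⟩
      · exact Or.inr ⟨x :: a, r, s, b, rfl, h⟩
  refine this.imp_left fun h => ⟨w.toFinset, ?_⟩
  have hnd : w.Nodup := h.imp (fun h => h.ne)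
  refine List.Perm.eq_of_pairwise' (r := (· ≤ ·)) (h.imp le_of_lt) (Finset.pairwise_sort _ _) ?_
  rw [List.perm_ext_iff_of_nodup hnd (Finset.sort_nodup _ _)]
  simp

/-- A word is either the monomial of a set without broken circuits, or it is divisible by the
leading word of a generator coming from the Gröbner circuits. -/
theorem exists_eq_sort_or_hasLeadingWord [Finite S] {𝓜 : Set (Finset S)} (h𝓜 : ∅ ∉ 𝓜) (x : R)
    (w : List S) :
    (∃ K : Finset S, NoBroken 𝓜 K ∧ w = K.sort (· ≤ ·)) ∨
      ∃ a u b, w = a ++ u ++ b ∧ ∃ g ∈ generators (x ^ 2) (groebnerCircuits 𝓜),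
        HasLeadingWord Q x u g := by
  rcases exists_eq_sort_or_descent w with ⟨K, rfl⟩ | ⟨a, r, s, b, rfl, h⟩
  · by_cases hK : NoBroken 𝓜 K
    · exact Or.inl ⟨K, hK, rfl⟩
    · obtain ⟨J, hJ, hne, hconv⟩ := exists_groebnerCircuit_convexSubset h𝓜 hK
      obtain ⟨a, b, hab⟩ := hconv.sort_eq
      exact Or.inr ⟨a, _, b, hab, _, Or.inr ⟨J, hJ, rfl⟩, hasLeadingWord_tMinus x hne⟩
  · refine Or.inr ⟨a, [r, s], b, rfl, ?_⟩
    rcases h.eq_or_lt with rfl | h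
    · exact ⟨_, Or.inl (Or.inl ⟨s, rfl⟩), hasLeadingWord_sq x s⟩
    · exact ⟨_, Or.inl (Or.inr ⟨r, s, h, rfl⟩), hasLeadingWord_comm x h⟩

end Leading

/-! ### The quotient algebra is spanned by monomials of sets without broken circuits -/

section Spanning

variable {R : Type v} [CommRing R] {S : Type u} [LinearOrder S]

variable (Q : Type w) [CommRing Q] [Algebra Q R]

/-- The quotient map as an algebra homomorphism. -/
def OSq.mkAlg (q : R) (𝓜 : Set (Finset S)) : FreeAlgebra R S →ₐ[Q] OSq q 𝓜 :=
  (defIdeal q 𝓜).ringCon.mkₐ Q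

variable {Q}

theorem OSq.mkAlg_apply (q : R) (𝓜 : Set (Finset S)) (f : FreeAlgebra R S) :
    OSq.mkAlg Q q 𝓜 f = OSq.mk q 𝓜 f := rfl

theorem OSq.mk_eq_zero_iff {q : R} {𝓜 : Set (Finset S)} {f : FreeAlgebra R S} :
    OSq.mk q 𝓜 f = 0 ↔ f ∈ defIdeal q 𝓜 := by
  conv_rhs => rw [← TwoSidedIdeal.ker_ringCon_mk' (defIdeal q 𝓜), TwoSidedIdeal.mem_ker]
  rfl

theorem OSq.mk_smul (q : R) (𝓜 : Set (Finset S)) (c : Q) (f : FreeAlgebra R S) :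
    OSq.mk q 𝓜 (c • f) = c • OSq.mk q 𝓜 f := map_smul (OSq.mkAlg Q q 𝓜) c f

theorem OSq.mk_surjective (q : R) (𝓜 : Set (Finset S)) : Function.Surjective (OSq.mk q 𝓜) :=
  RingCon.mk'_surjective _

theorem OSq.cliffordRel (q : R) (𝓜 : Set (Finset S)) :
    CliffordRel q fun s => OSq.mkAlg R q 𝓜 (tVar R s) := by
  have hsq : ∀ s, OSq.mkAlg R q 𝓜 (tVar R s) * OSq.mkAlg R q 𝓜 (tVar R s) =
      algebraMap R _ q := fun s => by
    rw [← map_mul, ← AlgHom.commutes (OSq.mkAlg R q 𝓜), ← sub_eq_zero, ← map_sub, ← pow_two]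
    exact OSq.mk_eq_zero_iff.2 (TwoSidedIdeal.subset_span (Or.inl (Or.inl ⟨s, rfl⟩)))
  have hlt : ∀ r s, s < r → OSq.mkAlg R q 𝓜 (tVar R r) * OSq.mkAlg R q 𝓜 (tVar R s) +
      OSq.mkAlg R q 𝓜 (tVar R s) * OSq.mkAlg R q 𝓜 (tVar R r) = algebraMap R _ (2 * q) :=
    fun r s h => by
    rw [← map_mul, ← map_mul, ← map_add, ← AlgHom.commutes (OSq.mkAlg R q 𝓜), ← sub_eq_zero,
      ← map_sub]
    exact OSq.mk_eq_zero_iff.2 (TwoSidedIdeal.subset_span (Or.inl (Or.inr ⟨r, s, h, rfl⟩)))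
  refine ⟨hsq, fun r s => ?_⟩
  rcases lt_trichotomy r s with h | rfl | h
  · rw [add_comm]
    exact hlt s r h
  · rw [hsq, ← map_add, two_mul]
  · exact hlt r s h

/-- The Clifford relations hold in the quotient, so `CliffordRel.minus_mem_of_sublist` applies there
with the zero ideal. -/
theorem tMinus_mem_defIdeal {q : R} {𝓜 : Set (Finset S)} (h𝓜 : ∅ ∉ 𝓜) {J : Finset S}
    (hJ : Dependent 𝓜 J) : tMinus q J ∈ defIdeal q 𝓜 := by
  obtain ⟨C, hC, hCJ⟩ := hJ
  obtain ⟨a, -, hsort⟩ := exists_sort_eq_cons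
    (Finset.nonempty_iff_ne_empty.2 fun h => h𝓜 (h ▸ hC) : C.Nonempty)
  have hmem : OSq.mkAlg R q 𝓜 (tMinus q C) = 0 :=
    OSq.mk_eq_zero_iff.2 (TwoSidedIdeal.subset_span (Or.inr ⟨C, hC, rfl⟩))
  rw [← OSq.mk_eq_zero_iff, ← OSq.mkAlg_apply (Q := R), (tMinus_eq_minusPlus q J).1,
    (map_minusPlus _ q _ _).1, ← TwoSidedIdeal.mem_bot]
  refine (OSq.cliffordRel q 𝓜).minus_mem_of_sublist _ (hsort ▸ sort_sublist_sort hCJ) ?_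
  rwa [← hsort, ← (map_minusPlus _ q _ _).1, ← (tMinus_eq_minusPlus q C).1, TwoSidedIdeal.mem_bot]

theorem generators_groebnerCircuits_subset [Finite S] {q : R} {𝓜 : Set (Finset S)} (h𝓜 : ∅ ∉ 𝓜)
    {g : FreeAlgebra R S} (hg : g ∈ generators q (groebnerCircuits 𝓜)) : g ∈ defIdeal q 𝓜 := by
  rcases hg with hg | ⟨J, hJ, rfl⟩
  · exact TwoSidedIdeal.subset_span (Or.inl hg)
  · have hJ : IsGroebnerCircuit 𝓜 J := hJ
    rw [IsGroebnerCircuit] at hJ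
    exact tMinus_mem_defIdeal h𝓜 hJ.1

/-- Every word is congruent to a combination of monomials of sets without broken circuits that
do not exceed it. -/
theorem mk_wordMon_mem_span [Finite S] {x : R} {𝓜 : Set (Finset S)} (h𝓜 : ∅ ∉ 𝓜) (w : List S) :
    OSq.mk (x ^ 2) 𝓜 (wordMon R w) ∈ Submodule.span Q
      {y | ∃ K : Finset S, NoBroken 𝓜 K ∧
        (WordLT (K.sort (· ≤ ·)) w ∨ K.sort (· ≤ ·) = w) ∧
        y = x ^ (w.length - K.card) • OSq.mk (x ^ 2) 𝓜 (tMon R K)} := by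
  induction w using (WordLT.wf S).induction with
  | _ w ih =>
  rcases exists_eq_sort_or_hasLeadingWord (Q := Q) h𝓜 x w with
    ⟨K, hK, rfl⟩ | ⟨a, u, b, rfl, g, hg, hgu⟩
  · exact Submodule.subset_span ⟨K, hK, Or.inr rfl, by simp [wordMon, tMon]⟩
  -- One reduction step: modulo g the word u is replaced by u - g, a combination of smaller words.
  · have h1 : OSq.mk (x ^ 2) 𝓜 (wordMon R (a ++ u ++ b)) =
        -OSq.mkAlg Q (x ^ 2) 𝓜 (wordMon R a * (g - wordMon R u) * wordMon R b) := by
      have h0 := OSq.mk_eq_zero_iff.2 (generators_groebnerCircuits_subset h𝓜 hg)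
      rw [OSq.mkAlg_apply, wordMon_append, wordMon_append]
      simp [h0]
    have h2 := wordMon_mul_homogSpan (m := (a ++ u ++ b).length) (W' := {v | WordLT v (a ++ u ++ b)})
      a b (fun v hv => WordLT.append hv a b) (by simp; omega) hgu
    rw [h1]
    refine neg_mem ?_
    generalize a ++ u ++ b = w at *
    have h3 : homogSpan Q x w.length {v | WordLT v w} ≤ Submodule.comap
        (OSq.mkAlg Q (x ^ 2) 𝓜).toLinearMap (Submodule.span Q
          {y | ∃ K : Finset S, NoBroken 𝓜 K ∧
            (WordLT (K.sort (· ≤ ·)) w ∨ K.sort (· ≤ ·) = w) ∧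
            y = x ^ (w.length - K.card) • OSq.mk (x ^ 2) 𝓜 (tMon R K)}) := by
      rw [homogSpan, Submodule.span_le]
      rintro _ ⟨v, hv, rfl⟩
      have h4 := ih v hv
      rw [SetLike.mem_coe, Submodule.mem_comap]
      change OSq.mk (x ^ 2) 𝓜 (x ^ (w.length - v.length) • wordMon R v) ∈ _
      rw [OSq.mk_smul]
      have hvw := hv.length_le
      generalize OSq.mk (x ^ 2) 𝓜 (wordMon R v) = y at h4 ⊢
      induction h4 using Submodule.span_induction with
      | mem y hy =>
        obtain ⟨K, hK, hKv, rfl⟩ := hy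
        -- With #K ≤ #v ≤ #w the truncated exponents add: (#w - #v) + (#v - #K) = #w - #K.
        have hKlen : K.card ≤ v.length := by
          rw [← Finset.length_sort (· ≤ ·) (s := K)]
          rcases hKv with h | h
          · exact h.length_le
          · rw [h]
        refine Submodule.subset_span ⟨K, hK, Or.inl ?_, ?_⟩
        · rcases hKv with h | h
          · exact h.trans hv
          · rwa [h]
        · rw [smul_smul, ← pow_add]
          congr 2
          omega
      | zero => simp
      | add y z _ _ hy hz => rw [smul_add]; exact add_mem hy hz
      | smul c y _ hy => rw [smul_comm]; exact Submodule.smul_mem _ _ hy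
    exact h3 h2

end Spanning

/-! ### Gradings defined by a basis -/

section BasisGrading

open Module

variable {K : Type v} {A : Type w} [CommRing K] [Ring A] [Algebra K A] {ι : Type u}

/-- The span of the basis vectors of degree `n`. -/
def degreePart (b : Basis ι K A) (deg : ι → ℕ) (n : ℕ) : Submodule K A :=
  Submodule.span K (b '' {i | deg i = n})

/-- The basis vectors of degree `n` form a basis of the part of degree `n`. -/
def degreePartBasis (b : Basis ι K A) (deg : ι → ℕ) (n : ℕ) :
    Basis {i // deg i = n} K (degreePart b deg n) :=
  (Basis.span (b.linearIndependent.comp (Subtype.val : {i // deg i = n} → ι)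
    Subtype.val_injective)).map (LinearEquiv.ofEq _ _ (by
      rw [degreePart, Set.range_comp, Subtype.range_coe_subtype]))

theorem isInternal_degreePart (b : Basis ι K A) (deg : ι → ℕ) :
    DirectSum.IsInternal (degreePart b deg) := by
  rw [DirectSum.isInternal_submodule_iff_iSupIndep_and_iSup_eq_top]
  constructor
  · intro n
    have h1 : ⨆ m, ⨆ (_ : m ≠ n), degreePart b deg m ≤ Submodule.span K (b '' {i | deg i ≠ n}) :=
      iSup₂_le fun m hm => Submodule.span_mono (Set.image_mono fun i hi => by
        have hi : deg i = m := hi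
        simpa [hi] using hm)
    refine Disjoint.mono_right h1 (b.linearIndependent.disjoint_span_image ?_)
    exact Set.disjoint_left.2 fun i hi hi' => hi' hi
  · rw [eq_top_iff, ← b.span_eq, Submodule.span_le]
    rintro _ ⟨i, rfl⟩
    exact Submodule.mem_iSup_of_mem (deg i) (Submodule.subset_span ⟨i, rfl, rfl⟩)

theorem isStandardGraded_degreePart (b : Basis ι K A) (deg : ι → ℕ)
    (hfin : ∀ n, Finite {i // deg i = n}) (i₀ : ι) (h₁ : b i₀ = 1) (h₀ : deg i₀ = 0)
    (huniq : ∀ i, deg i = 0 → i = i₀)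
    (hmul : ∀ i j, b i * b j ∈ degreePart b deg (deg i + deg j))
    (hgen : ∀ i, b i ∈ Algebra.adjoin K (degreePart b deg 1 : Set A)) :
    IsStandardGraded K (degreePart b deg) where
  gradedMonoid :=
    { one_mem := h₁ ▸ Submodule.subset_span ⟨i₀, h₀, rfl⟩
      mul_mem := by
        intro m n x y hx hy
        have h : degreePart b deg m * degreePart b deg n ≤ degreePart b deg (m + n) := by
          rw [degreePart, degreePart, Submodule.span_mul_span, Submodule.span_le]
          rintro _ ⟨_, ⟨i, rfl, rfl⟩, _, ⟨j, rfl, rfl⟩, rfl⟩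
          exact hmul i j
        exact h (Submodule.mul_mem_mul hx hy) }
  isInternal := isInternal_degreePart b deg
  algebraMap_injective := by
    intro r s h
    rw [Algebra.algebraMap_eq_smul_one, Algebra.algebraMap_eq_smul_one, ← h₁] at h
    simpa using congrArg (fun f => f i₀) (congrArg b.repr h)
  degree_zero := by
    have h : {i | deg i = 0} = {i₀} := by
      ext i
      exact ⟨huniq i, fun hi => by rw [Set.mem_singleton_iff.1 hi]; exact h₀⟩
    ext x
    rw [degreePart, h, Set.image_singleton, h₁, SetLike.mem_coe, Submodule.mem_span_singleton,
      Set.mem_range]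
    simp only [Algebra.algebraMap_eq_smul_one]
  degree_one_finite := Module.Finite.of_basis (degreePartBasis b deg 1)
  generated := by
    rw [← Algebra.toSubmodule_eq_top, eq_top_iff, ← b.span_eq, Submodule.span_le]
    rintro _ ⟨i, rfl⟩
    exact hgen i

theorem finrank_degreePart [Nontrivial K] (b : Basis ι K A) (deg : ι → ℕ) (n : ℕ) :
    finrank K (degreePart b deg n) = Nat.card {i // deg i = n} :=
  finrank_eq_nat_card_basis (degreePartBasis b deg n)

end BasisGrading

/-! ### The monomial bases -/

section MonomialBasis

open Module

variable {S : Type u} [LinearOrder S] {M : Matroid S}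

/-- An empty broken circuit would come from a one-element circuit, that is, a loop. -/
theorem noBroken_empty (hloop : M.Loopless) : NoBroken (circuits M) ∅ := by
  intro C hC h
  have hC' : M.IsCircuit (C : Set S) := hC
  obtain ⟨a, -, ha⟩ := exists_eq_insert_eraseMin (J := C) (by simpa using hC'.nonempty)
  rw [Finset.subset_empty.1 h] at ha
  rw [ha] at hC'
  exact M.not_isLoop a (Matroid.singleton_isCircuit.1 (by simpa using hC'))

variable {R : Type v} [CommRing R]

variable (R) in
theorem span_mk_wordMon {Q : Type w} [CommRing Q] [Algebra Q R] (q : R) (𝓜 : Set (Finset S))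
    {N : Submodule R (OSq q 𝓜)} (h : ∀ w, OSq.mk q 𝓜 (wordMon R w) ∈ N) : N = ⊤ := by
  rw [eq_top_iff]
  intro y _
  obtain ⟨f, rfl⟩ := OSq.mk_surjective q 𝓜 y
  have hf : f ∈ (⊤ : Submodule R (FreeAlgebra R S)) := trivial
  rw [← (FreeAlgebra.basisFreeMonoid R S).span_eq] at hf
  have h2 : Submodule.span R (Set.range (FreeAlgebra.basisFreeMonoid R S)) ≤
      N.comap (OSq.mkAlg R q 𝓜).toLinearMap := by
    rw [Submodule.span_le]
    rintro _ ⟨w, rfl⟩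
    rw [basisFreeMonoid_apply]
    exact h _
  exact h2 hf

theorem OSq.mk_wordMon_mem_of_subalgebra {Q : Type w} [CommRing Q] [Algebra Q R] (q : R)
    (𝓜 : Set (Finset S)) {B : Subalgebra Q (OSq q 𝓜)}
    (h : ∀ s, OSq.mk q 𝓜 (tVar R s) ∈ B) (w : List S) : OSq.mk q 𝓜 (wordMon R w) ∈ B := by
  rw [wordMon, map_list_prod]
  refine list_prod_mem fun y hy => ?_
  simp only [List.mem_map] at hy
  obtain ⟨_, ⟨s, -, rfl⟩, rfl⟩ := hy
  exact h s

variable [Finite S]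

/-- The basis of the deformed algebra formed by the monomials of the sets that contain no broken
circuit. -/
def nbcBasis (hE : M.E = Set.univ) (hloop : M.Loopless) (x : R) :
    Basis {K : Finset S // NoBroken (circuits M) K} R (OSq (x ^ 2) (circuits M)) :=
  Basis.mk (linearIndependent_mk_tMon hE hloop (x ^ 2)) (by
    refine (span_mk_wordMon (Q := R) R (x ^ 2) (circuits M) fun w => ?_).ge
    refine Submodule.span_le.2 ?_ (mk_wordMon_mem_span (Q := R) empty_notMem_circuits w)
    rintro _ ⟨K, hK, -, rfl⟩
    exact Submodule.smul_mem _ _ (Submodule.subset_span ⟨⟨K, hK⟩, rfl⟩))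

theorem nbcBasis_apply (hE : M.E = Set.univ) (hloop : M.Loopless) (x : R)
    (K : {K : Finset S // NoBroken (circuits M) K}) :
    nbcBasis hE hloop x K = OSq.mk (x ^ 2) (circuits M) (tMon R K.1) :=
  Basis.mk_apply _ _ _

/-- For x = 0 the coefficient x^(#w - #K) vanishes unless #K = #w, so reduction preserves the
length. -/
theorem osPart_eq {k : Type v} [Field k] (hE : M.E = Set.univ) (hloop : M.Loopless) (n : ℕ) :
    Submodule.span k {x | ∃ v : FreeMonoid S, v.length = n ∧
      x = OSq.mk ((0 : k) ^ 2) (circuits M) (FreeAlgebra.basisFreeMonoid k S v)} =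
      degreePart (nbcBasis hE hloop (0 : k)) (fun K => K.1.card) n := by
  refine le_antisymm (Submodule.span_le.2 ?_) (Submodule.span_le.2 ?_)
  · rintro _ ⟨w, rfl, rfl⟩
    rw [basisFreeMonoid_apply]
    refine Submodule.span_le.2 ?_ (mk_wordMon_mem_span (Q := k) empty_notMem_circuits w.toList)
    rintro _ ⟨K, hK, hKw, rfl⟩
    rcases eq_or_ne (w.toList.length - K.card) 0 with h | h
    · rw [h, pow_zero, one_smul]
      refine Submodule.subset_span ⟨⟨K, hK⟩, ?_, nbcBasis_apply _ _ _ _⟩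
      have : K.card ≤ w.toList.length := by
        rw [← Finset.length_sort (· ≤ ·) (s := K)]
        rcases hKw with h | h
        · exact h.length_le
        · rw [h]
      exact this.antisymm (Nat.sub_eq_zero_iff_le.1 h)
    · rw [zero_pow h, zero_smul]
      exact zero_mem _
  · rintro _ ⟨K, rfl, rfl⟩
    refine Submodule.subset_span ⟨FreeMonoid.ofList (K.1.sort (· ≤ ·)), ?_, ?_⟩
    · exact Finset.length_sort _
    · rw [nbcBasis_apply, basisFreeMonoid_apply]
      rfl

end MonomialBasis

/-! ### The algebra over `Q` -/

section PolynomialCase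

open Module

variable {Q : Type v} [CommRing Q] {S : Type u}

variable (Q S) in
/-- The monomials `t₀ⁱ w` as a `Q`-basis of the free algebra over `Q[t₀]`. -/
def monBasis : Basis (ℕ × FreeMonoid S) Q (FreeAlgebra (Polynomial Q) S) :=
  (Polynomial.basisMonomials Q).smulTower (FreeAlgebra.basisFreeMonoid (Polynomial Q) S)

theorem monBasis_apply (m : ℕ × FreeMonoid S) : monBasis Q S m = monTerm 1 m := by
  simp [monBasis, Basis.smulTower_apply, monTerm]

theorem monBasis_repr (f : FreeAlgebra (Polynomial Q) S) (m : ℕ × FreeMonoid S) :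
    (monBasis Q S).repr f m = coeffAt f m := by
  rw [monBasis, Basis.smulTower_repr]
  rfl

theorem monTerm_eq_smul (c : Q) (m : ℕ × FreeMonoid S) : monTerm c m = c • monBasis Q S m := by
  rw [monBasis_apply, monTerm, monTerm, ← smul_assoc, Polynomial.smul_monomial, smul_eq_mul,
    mul_one]

theorem monTerm_one (m : ℕ × FreeMonoid S) :
    monTerm (1 : Q) m = (Polynomial.X : Polynomial Q) ^ m.1 • wordMon _ m.2.toList := by
  rw [monTerm, basisFreeMonoid_apply, Polynomial.X_pow_eq_monomial]

theorem monTerm_mul (c d : Q) (i j : ℕ) (a b : FreeMonoid S) :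
    monTerm c (i, a) * monTerm d (j, b) = monTerm (c * d) (i + j, a * b) := by
  simp only [monTerm, smul_mul_smul_comm, Polynomial.monomial_mul_monomial, basisFreeMonoid_apply,
    FreeMonoid.toList_mul, wordMon_append]

theorem homogSpan_eq_span_monBasis (n : ℕ) (W : Set (List S)) :
    homogSpan Q (Polynomial.X : Polynomial Q) n W =
      Submodule.span Q (monBasis Q S ''
        ((fun v => (n - v.length, FreeMonoid.ofList v)) '' W)) := by
  rw [homogSpan, Set.image_image]
  congr 2
  ext1 v
  rw [monBasis_apply, monTerm_one]
  rfl

theorem mk_monTerm [LinearOrder S] (q : Polynomial Q) (𝓜 : Set (Finset S)) (m : ℕ × FreeMonoid S) :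
    OSq.mk q 𝓜 (monTerm 1 m) =
      (Polynomial.X : Polynomial Q) ^ m.1 • OSq.mk q 𝓜 (wordMon _ m.2.toList) := by
  rw [monTerm_one, OSq.mk_smul]

variable [LinearOrder S]

theorem lex_map_coe {v u : List S} (h : List.Lex (· < ·) v u) :
    List.Lex (· < ·) (v.map fun s => (s : WithBot S)) (u.map fun s => (s : WithBot S)) := by
  induction h with
  | nil => exact .nil
  | cons _ ih => exact .cons ih
  | rel h => exact .rel (WithBot.coe_lt_coe.2 h)

/-- Padding with t₀ makes the lengths equal. If v is shorter, then after the common t₀ⁱ the least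
letter t₀ meets the first letter of u; otherwise the lexicographic comparison is inherited. -/
theorem wordLT_toWord {v u : List S} (h : WordLT v u) (i : ℕ) :
    WordLT (toWord (i + (u.length - v.length), FreeMonoid.ofList v))
      (toWord (i, FreeMonoid.ofList u)) := by
  have hlen := h.length_le
  simp only [toWord, List.replicate_add, List.append_assoc, FreeMonoid.toList_ofList]
  refine List.Shortlex.append_left ?_ _
  refine List.Shortlex.of_lex (by simp; omega) ?_
  rcases List.shortlex_def.1 h with h | ⟨h, h'⟩
  · cases u with
    | nil => simp at h
    | cons a u =>
      rw [List.length_cons] at h ⊢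
      rw [Nat.succ_sub (Nat.lt_succ_iff.1 h), List.replicate_succ]
      exact .rel (WithBot.bot_lt_coe a)
  · rw [h, Nat.sub_self]
    exact lex_map_coe h'

theorem IsLeadingTerm.of_hasLeadingWord [Nontrivial Q] {u : List S}
    {g : FreeAlgebra (Polynomial Q) S} (h : HasLeadingWord Q Polynomial.X u g) :
    IsLeadingTerm g (monTerm 1 (0, FreeMonoid.ofList u)) := by
  rw [HasLeadingWord, homogSpan_eq_span_monBasis, Basis.mem_span_image] at h
  have hg : g = monBasis Q S (0, FreeMonoid.ofList u) + (g - wordMon _ u) := by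
    rw [monBasis_apply, monTerm_one]
    simp
  have hcoeff : ∀ m, coeffAt g m ≠ 0 → m = (0, FreeMonoid.ofList u) ∨
      ∃ v, WordLT v u ∧ m = (u.length - v.length, FreeMonoid.ofList v) := by
    intro m hm
    by_cases hmu : m = (0, FreeMonoid.ofList u)
    · exact Or.inl hmu
    · rw [← monBasis_repr, hg, map_add, Finsupp.add_apply, Basis.repr_self,
        Finsupp.single_eq_of_ne hmu, zero_add] at hm
      obtain ⟨v, hv, rfl⟩ := h (Finsupp.mem_support_iff.2 hm)
      exact Or.inr ⟨v, hv, rfl⟩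
  have hone : coeffAt g (0, FreeMonoid.ofList u) = 1 := by
    rw [← monBasis_repr, hg, map_add, Finsupp.add_apply, Basis.repr_self, Finsupp.single_eq_same]
    by_contra hne
    have h0 : (monBasis Q S).repr (g - wordMon _ u) (0, FreeMonoid.ofList u) ≠ 0 := by
      intro h0
      rw [h0, add_zero] at hne
      exact hne rfl
    obtain ⟨v, hv, he⟩ := h (Finsupp.mem_support_iff.2 h0)
    have : v = u := FreeMonoid.ofList.injective (Prod.ext_iff.1 he).2
    rw [this] at hv
    exact WordLT.irrefl u hv
  refine ⟨(0, FreeMonoid.ofList u), by rw [hone]; exact one_ne_zero, fun m hm hmu => ?_,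
    by rw [hone]⟩
  obtain ⟨v, hv, rfl⟩ := (hcoeff m hm).resolve_left hmu
  simpa using wordLT_toWord hv 0

variable [Finite S] {M : Matroid S}

variable (Q) in
/-- The monomials `t₀ⁱ t_K`, for `K` containing no broken circuit, as a `Q`-basis of the deformed
algebra. -/
def nbcPolyBasis (hE : M.E = Set.univ) (hloop : M.Loopless) :
    Basis (ℕ × {K : Finset S // NoBroken (circuits M) K}) Q
      (OSq (Polynomial.X ^ 2 : Polynomial Q) (circuits M)) :=
  (Polynomial.basisMonomials Q).smulTower (nbcBasis hE hloop Polynomial.X)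

theorem nbcPolyBasis_apply (hE : M.E = Set.univ) (hloop : M.Loopless)
    (p : ℕ × {K : Finset S // NoBroken (circuits M) K}) :
    nbcPolyBasis Q hE hloop p =
      (Polynomial.X : Polynomial Q) ^ p.1 • OSq.mk _ (circuits M) (tMon _ p.2.1) := by
  rw [nbcPolyBasis, Basis.smulTower_apply, nbcBasis_apply, Polynomial.coe_basisMonomials]
  congr 1
  exact (Polynomial.X_pow_eq_monomial _).symm

theorem nbcPolyBasis_eq_mk (hE : M.E = Set.univ) (hloop : M.Loopless)
    (p : ℕ × {K : Finset S // NoBroken (circuits M) K}) :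
    nbcPolyBasis Q hE hloop p =
      OSq.mk _ (circuits M) (monTerm 1 (p.1, FreeMonoid.ofList (p.2.1.sort (· ≤ ·)))) := by
  rw [nbcPolyBasis_apply, mk_monTerm]
  rfl

/-- Every monomial is congruent to a combination of basis monomials that do not exceed it. -/
theorem mk_monTerm_mem_span (hE : M.E = Set.univ) (hloop : M.Loopless) (m : ℕ × FreeMonoid S) :
    OSq.mk (Polynomial.X ^ 2 : Polynomial Q) (circuits M) (monTerm 1 m) ∈
      Submodule.span Q (nbcPolyBasis Q hE hloop '' {p | p.1 + p.2.1.card = m.1 + m.2.length ∧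
        (WordLT (toWord (p.1, FreeMonoid.ofList (p.2.1.sort (· ≤ ·)))) (toWord m) ∨
          (p.1, FreeMonoid.ofList (p.2.1.sort (· ≤ ·))) = m)}) := by
  obtain ⟨i, w⟩ := m
  have h := mk_wordMon_mem_span (Q := Q) (x := (Polynomial.X : Polynomial Q))
    (empty_notMem_circuits (M := M)) w.toList
  rw [mk_monTerm]
  dsimp only
  generalize OSq.mk _ (circuits M) (wordMon (Polynomial Q) w.toList) = y at h ⊢
  induction h using Submodule.span_induction with
  | mem y hy =>
    obtain ⟨K, hK, hKw, rfl⟩ := hy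
    have hcard : K.card ≤ w.toList.length := by
      rw [← Finset.length_sort (· ≤ ·) (s := K)]
      rcases hKw with h | h
      · exact h.length_le
      · rw [h]
    refine Submodule.subset_span ⟨(i + (w.toList.length - K.card), ⟨K, hK⟩), ⟨?_, ?_⟩, ?_⟩
    · change i + (w.toList.length - K.card) + K.card = i + w.toList.length
      omega
    · rcases hKw with h | h
      · left
        have := wordLT_toWord h i
        rwa [Finset.length_sort] at this
      · right
        have hlen : w.toList.length = K.card := by rw [← h, Finset.length_sort]
        simp [hlen, h]
    · rw [nbcPolyBasis_apply, smul_smul, ← pow_add]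
  | zero => simp
  | add y z _ _ hy hz => rw [smul_add]; exact add_mem hy hz
  | smul c y _ hy => rw [smul_comm]; exact Submodule.smul_mem _ _ hy

theorem homogPart_eq (hE : M.E = Set.univ) (hloop : M.Loopless) :
    homogPart Q (circuits M) =
      degreePart (nbcPolyBasis Q hE hloop) (fun p => p.1 + p.2.1.card) := by
  ext1 n
  refine le_antisymm (Submodule.span_le.2 ?_) (Submodule.span_le.2 ?_)
  · rintro _ ⟨m, rfl, rfl⟩
    exact Submodule.span_mono (Set.image_mono fun p hp => hp.1) (mk_monTerm_mem_span hE hloop m)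
  · rintro _ ⟨p, rfl, rfl⟩
    refine Submodule.subset_span ⟨(p.1, FreeMonoid.ofList (p.2.1.sort (· ≤ ·))), ?_,
      nbcPolyBasis_eq_mk hE hloop p⟩
    simp [FreeMonoid.length]

/-- Reduction never increases a monomial, so smaller monomials cannot contribute to the coordinate
at p. -/
theorem repr_mk_eq_zero (hE : M.E = Set.univ) (hloop : M.Loopless)
    (p : ℕ × {K : Finset S // NoBroken (circuits M) K}) {f : FreeAlgebra (Polynomial Q) S}
    (h : ∀ m, coeffAt f m ≠ 0 →
      WordLT (toWord m) (toWord (p.1, FreeMonoid.ofList (p.2.1.sort (· ≤ ·))))) :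
    (nbcPolyBasis Q hE hloop).repr (OSq.mk _ (circuits M) f) p = 0 := by
  have hf : f ∈ Submodule.span Q (monBasis Q S '' {m |
      WordLT (toWord m) (toWord (p.1, FreeMonoid.ofList (p.2.1.sort (· ≤ ·))))}) := by
    rw [Basis.mem_span_image]
    intro m hm
    rw [Finset.mem_coe, Finsupp.mem_support_iff, monBasis_repr] at hm
    exact h m hm
  have hle : Submodule.span Q (monBasis Q S '' {m |
      WordLT (toWord m) (toWord (p.1, FreeMonoid.ofList (p.2.1.sort (· ≤ ·))))}) ≤
      LinearMap.ker ((nbcPolyBasis Q hE hloop).coord p ∘ₗ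
        (OSq.mkAlg Q (Polynomial.X ^ 2 : Polynomial Q) (circuits M)).toLinearMap) := by
    rw [Submodule.span_le]
    rintro _ ⟨m, hm, rfl⟩
    have h1 := mk_monTerm_mem_span (Q := Q) hE hloop m
    rw [Basis.mem_span_image] at h1
    rw [SetLike.mem_coe, LinearMap.mem_ker, monBasis_apply]
    change (nbcPolyBasis Q hE hloop).repr (OSq.mk _ (circuits M) (monTerm 1 m)) p = 0
    by_contra hne
    obtain ⟨-, h2⟩ := h1 (Finsupp.mem_support_iff.2 hne)
    rcases h2 with h2 | h2
    · exact WordLT.irrefl _ (h2.trans hm)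
    · rw [h2] at hm
      exact WordLT.irrefl _ hm
  exact hle hf

theorem isGroebnerBasis_generators (hE : M.E = Set.univ) (hloop : M.Loopless) :
    IsGroebnerBasis (generators (Polynomial.X ^ 2 : Polynomial Q) (groebnerCircuits (circuits M)))
      (defIdeal (Polynomial.X ^ 2 : Polynomial Q) (circuits M)) := by
  have hsub : ∀ g ∈ generators (Polynomial.X ^ 2 : Polynomial Q) (groebnerCircuits (circuits M)),
      g ∈ defIdeal (Polynomial.X ^ 2 : Polynomial Q) (circuits M) :=
    fun g hg => generators_groebnerCircuits_subset empty_notMem_circuits hg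
  refine ⟨hsub, le_antisymm (TwoSidedIdeal.span_mono ?_) (TwoSidedIdeal.span_le.2 ?_)⟩
  · rintro g ⟨f, hf, hfg⟩
    exact ⟨f, hsub f hf, hfg⟩
  · rintro _ ⟨f, hf, ⟨i, w⟩, hne, hlt, rfl⟩
    have : Nontrivial Q := nontrivial_of_ne _ _ hne
    rcases exists_eq_sort_or_hasLeadingWord (R := Polynomial Q) (Q := Q)
      (empty_notMem_circuits (M := M)) Polynomial.X w.toList with
      ⟨K, hK, hw⟩ | ⟨a, u, b, hw, g, hg, hgu⟩
    -- Here the leading monomial is a basis monomial of the quotient. The lower terms of f do not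
    -- reach its coordinate, so the image of f has minus the coordinate of nothing but the leading
    -- coefficient to cancel: 0 = f would force that coefficient to vanish.
    · exfalso
      have hw : w = FreeMonoid.ofList (K.sort (· ≤ ·)) := by rw [← hw, FreeMonoid.ofList_toList]
      subst hw
      have h1 := repr_mk_eq_zero hE hloop (i, ⟨K, hK⟩)
        (f := f - monTerm (coeffAt f (i, FreeMonoid.ofList (K.sort (· ≤ ·))))
          (i, FreeMonoid.ofList (K.sort (· ≤ ·)))) (by
        intro m hm
        rw [← monBasis_repr, map_sub, monTerm_eq_smul, map_smul, Basis.repr_self,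
          Finsupp.sub_apply, Finsupp.smul_apply, monBasis_repr] at hm
        by_cases hmK : m = (i, FreeMonoid.ofList (K.sort (· ≤ ·)))
        · rw [hmK, Finsupp.single_eq_same, smul_eq_mul, mul_one, sub_self] at hm
          exact absurd rfl hm
        · rw [Finsupp.single_eq_of_ne hmK, smul_zero, sub_zero] at hm
          exact hlt m hm hmK)
      have h0 : OSq.mk (Polynomial.X ^ 2 : Polynomial Q) (circuits M) f = 0 :=
        OSq.mk_eq_zero_iff.2 hf
      rw [map_sub, h0, zero_sub, map_neg, monTerm_eq_smul, OSq.mk_smul, monBasis_apply,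
        ← nbcPolyBasis_eq_mk hE hloop (i, ⟨K, hK⟩), map_smul, Basis.repr_self] at h1
      simp only [Finsupp.neg_apply, Finsupp.smul_apply, Finsupp.single_eq_same, smul_eq_mul,
        mul_one, neg_eq_zero] at h1
      exact hne h1
    · have hw : w = FreeMonoid.ofList a * FreeMonoid.ofList u * FreeMonoid.ofList b := by
        rw [← FreeMonoid.ofList_append, ← FreeMonoid.ofList_append, ← hw, FreeMonoid.ofList_toList]
      have hlead : monTerm (1 : Q) (0, FreeMonoid.ofList u) ∈ TwoSidedIdeal.span (leadingTerms
          (generators (Polynomial.X ^ 2 : Polynomial Q) (groebnerCircuits (circuits M)))) :=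
        TwoSidedIdeal.subset_span ⟨g, hg, IsLeadingTerm.of_hasLeadingWord hgu⟩
      generalize coeffAt f (i, w) = c
      -- The leading coefficient of g is 1, so c and t₀ⁱ go into the left cofactor; no division in Q
      -- is needed.
      have : monTerm c (i, w) = monTerm c (i, FreeMonoid.ofList a) *
          monTerm 1 (0, FreeMonoid.ofList u) * monTerm 1 (0, FreeMonoid.ofList b) := by
        rw [monTerm_mul, monTerm_mul, hw]
        simp
      rw [this]
      exact TwoSidedIdeal.mul_mem_right _ _ _ (TwoSidedIdeal.mul_mem_left _ _ _ hlead)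

theorem finite_polyDegree (𝓜 : Set (Finset S)) (n : ℕ) :
    Finite {p : ℕ × {K : Finset S // NoBroken 𝓜 K} // p.1 + p.2.1.card = n} := by
  refine Set.Finite.subset ((Set.finite_Iic n).prod (Set.finite_univ
    (α := {K : Finset S // NoBroken 𝓜 K}))) fun p hp => ⟨?_, trivial⟩
  have hp : p.1 + p.2.1.card = n := hp
  simp only [Set.mem_Iic]
  omega

theorem isStandardGraded_homogPart (hE : M.E = Set.univ) (hloop : M.Loopless) :
    IsStandardGraded Q (homogPart Q (circuits M)) := by
  have hpart := homogPart_eq (Q := Q) hE hloop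
  rw [hpart]
  refine isStandardGraded_degreePart _ _ (finite_polyDegree _) (0, ⟨∅, noBroken_empty hloop⟩)
    ?_ rfl ?_ ?_ ?_
  · rw [nbcPolyBasis_apply]
    simp [tMon]
  · rintro ⟨i, K, hK⟩ h
    simp only [Nat.add_eq_zero_iff, Finset.card_eq_zero] at h
    obtain ⟨rfl, rfl⟩ := h
    rfl
  · intro p p'
    rw [← hpart, nbcPolyBasis_eq_mk, nbcPolyBasis_eq_mk, ← map_mul, monTerm_mul, mul_one]
    refine Submodule.subset_span ⟨_, ?_, rfl⟩
    simp [FreeMonoid.length]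
    omega
  · intro p
    rw [← hpart, nbcPolyBasis_eq_mk, mk_monTerm, Algebra.smul_def]
    have hX : algebraMap (Polynomial Q) (OSq (Polynomial.X ^ 2 : Polynomial Q) (circuits M))
        Polynomial.X = OSq.mk _ (circuits M) (monTerm 1 (1, 1)) := by
      rw [mk_monTerm, Algebra.algebraMap_eq_smul_one]
      simp [wordMon]
    rw [map_pow, hX]
    have h1 : ∀ m : ℕ × FreeMonoid S, m.1 + m.2.length = 1 →
        OSq.mk (Polynomial.X ^ 2 : Polynomial Q) (circuits M) (monTerm 1 m) ∈
          Algebra.adjoin Q (homogPart Q (circuits M) 1 : Set _) :=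
      fun m hm => Algebra.subset_adjoin (Submodule.subset_span ⟨m, hm, rfl⟩)
    refine mul_mem (pow_mem (h1 (1, 1) (by simp)) _)
      (OSq.mk_wordMon_mem_of_subalgebra _ _ (fun s => ?_) _)
    have h2 := h1 (0, FreeMonoid.of s) (by simp)
    rw [mk_monTerm] at h2
    simpa [wordMon] using h2

theorem isStandardGraded_osPart {k : Type v} [Field k] (hE : M.E = Set.univ)
    (hloop : M.Loopless) :
    IsStandardGraded k (degreePart (nbcBasis hE hloop (0 : k)) fun K => K.1.card) := by
  refine isStandardGraded_degreePart _ _ (fun n => inferInstance) ⟨∅, noBroken_empty hloop⟩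
    ?_ rfl ?_ ?_ ?_
  · rw [nbcBasis_apply]
    simp [tMon]
  · rintro ⟨K, hK⟩ h
    simp only [Finset.card_eq_zero] at h
    subst h
    rfl
  · intro K K'
    rw [← osPart_eq, nbcBasis_apply, nbcBasis_apply, ← map_mul]
    refine Submodule.subset_span ⟨FreeMonoid.ofList (K.1.sort (· ≤ ·)) *
      FreeMonoid.ofList (K'.1.sort (· ≤ ·)), by simp [FreeMonoid.length], ?_⟩
    rw [basisFreeMonoid_apply, FreeMonoid.toList_mul, wordMon_append]
    rfl
  · intro K
    rw [← osPart_eq, nbcBasis_apply]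
    refine OSq.mk_wordMon_mem_of_subalgebra _ _ (fun s => Algebra.subset_adjoin ?_) _
    refine Submodule.subset_span ⟨FreeMonoid.of s, by simp, ?_⟩
    rw [basisFreeMonoid_apply]
    simp [wordMon]

end PolynomialCase

/-! ### Hilbert series -/

section Hilbert

variable {S : Type u} [LinearOrder S] {M : Matroid S}

theorem nbcCount_zero (hloop : M.Loopless) : nbcCount M 0 = 1 := by
  rw [nbcCount, Set.ncard_eq_one]
  refine ⟨∅, Set.ext fun J => ⟨fun h => Finset.card_eq_zero.1 h.1, ?_⟩⟩
  rintro rfl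
  exact ⟨rfl, noBroken_empty hloop⟩

theorem nbcCount_eq_natCard (n : ℕ) :
    nbcCount M n = Nat.card {K : {K : Finset S // NoBroken (circuits M) K} // K.1.card = n} := by
  rw [nbcCount, ← Nat.card_coe_set_eq]
  exact Nat.card_congr ⟨fun K => ⟨⟨K.1, K.2.2⟩, K.2.1⟩, fun K => ⟨K.1.1, K.2, K.1.2⟩,
    fun _ => rfl, fun _ => rfl⟩

variable [Finite S]

theorem nbcCount_eq_zero (hE : M.E = Set.univ) {n : ℕ} (hn : M.eRank.toNat < n) :
    nbcCount M n = 0 := by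
  rw [nbcCount, Set.ncard_eq_zero (Set.toFinite _), Set.eq_empty_iff_forall_notMem]
  rintro J ⟨rfl, hJ⟩
  have hJ : NoBroken (circuits M) J := hJ
  have h1 := (hJ.indep hE).encard_le_eRank
  have htop : M.eRank ≠ ⊤ :=
    ne_top_of_le_ne_top (Set.encard_ne_top_iff.2 (Set.toFinite _)) M.eRank_le_encard_ground
  rw [Set.encard_coe_eq_coe_finsetCard, ← ENat.natCast_toNat htop] at h1
  have h1 : J.card ≤ M.eRank.toNat := by exact_mod_cast h1
  omega

/-- The exponent is determined by K as n - #K, so the pairs correspond to the nbc sets with at most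
n elements. -/
theorem natCard_polyDegree (n : ℕ) :
    Nat.card {p : ℕ × {K : Finset S // NoBroken (circuits M) K} // p.1 + p.2.1.card = n} =
      ∑ i ∈ Finset.range (n + 1), nbcCount M i := by
  classical
  have := Fintype.ofFinite {K : Finset S // NoBroken (circuits M) K}
  have e : {p : ℕ × {K : Finset S // NoBroken (circuits M) K} // p.1 + p.2.1.card = n} ≃
      {K : {K : Finset S // NoBroken (circuits M) K} // K.1.card ≤ n} :=
    { toFun := fun p => ⟨p.1.2, by have := p.2; omega⟩
      invFun := fun K => ⟨(n - K.1.1.card, K.1), Nat.sub_add_cancel K.2⟩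
      left_inv := by
        rintro ⟨⟨i, K⟩, h⟩
        simp only [Subtype.mk.injEq, Prod.mk.injEq, and_true]
        simp only at h
        omega
      right_inv := fun _ => rfl }
  rw [Nat.card_congr e, Nat.card_eq_fintype_card, Fintype.card_subtype,
    Finset.card_eq_sum_card_fiberwise (f := fun K => K.1.card) (t := Finset.range (n + 1))]
  · refine Finset.sum_congr rfl fun i hi => ?_
    rw [nbcCount_eq_natCard, Nat.card_eq_fintype_card, Fintype.card_subtype, Finset.filter_filter]
    congr 1
    refine Finset.filter_congr fun K _ => ?_
    rw [Finset.mem_range] at hi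
    omega
  · intro K hK
    simp only [Finset.coe_filter, Finset.mem_univ, true_and, Set.mem_ofPred_eq] at hK
    simpa [Nat.lt_succ_iff] using hK

theorem powerSeries_mk_sum_range (c : ℕ → ℚ) :
    PowerSeries.mk (fun n => ∑ i ∈ Finset.range (n + 1), c i) =
      PowerSeries.mk c * (1 - PowerSeries.X)⁻¹ := by
  rw [PowerSeries.eq_mul_inv_iff_mul_eq (by simp), mul_sub, mul_one]
  ext n
  cases n with
  | zero => simp
  | succ n =>
    rw [map_sub, PowerSeries.coeff_succ_mul_X]
    simp [Finset.sum_range_succ _ (n + 1)]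

theorem powerSeries_mk_nbcCount (hE : M.E = Set.univ) (hloop : M.Loopless) :
    PowerSeries.mk (fun n => (nbcCount M n : ℚ)) =
      1 + ∑ i ∈ Finset.Icc 1 M.eRank.toNat,
        PowerSeries.C (nbcCount M i : ℚ) * PowerSeries.X ^ i := by
  ext n
  simp only [PowerSeries.coeff_mk, map_add, map_sum, PowerSeries.coeff_C_mul,
    PowerSeries.coeff_X_pow, PowerSeries.coeff_one, mul_ite, mul_one, mul_zero,
    Finset.sum_ite_eq, Finset.mem_Icc]
  rcases Nat.eq_zero_or_pos n with rfl | hn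
  · simp [nbcCount_zero hloop]
  · rw [if_neg hn.ne', zero_add]
    split_ifs with h
    · rfl
    · rw [nbcCount_eq_zero hE (by omega), Nat.cast_zero]

theorem hilbertSeries_homogPart {Q : Type v} [CommRing Q] [Nontrivial Q] (hE : M.E = Set.univ)
    (hloop : M.Loopless) :
    hilbertSeries Q (homogPart Q (circuits M)) =
      PowerSeries.mk (fun n => (nbcCount M n : ℚ)) * (1 - PowerSeries.X)⁻¹ := by
  rw [← powerSeries_mk_sum_range, hilbertSeries, homogPart_eq hE hloop]
  congr 1
  ext1 n
  rw [finrank_degreePart, natCard_polyDegree, Nat.cast_sum]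

theorem isStandardGraded_and_hilbertSeries_osPart {k : Type v} [Field k] (hE : M.E = Set.univ)
    (hloop : M.Loopless) :
    IsStandardGraded k (osPart k (circuits M)) ∧
      hilbertSeries k (osPart k (circuits M)) =
        PowerSeries.mk fun n => (nbcCount M n : ℚ) := by
  -- The basis lives in the algebra for 0 ^ 2 and the claim in that for 0. A variable q lets the
  -- equation be substituted in the type.
  have h : ∀ q : k, q = 0 ^ 2 →
      let 𝒜 : ℕ → Submodule k (OSq q (circuits M)) := fun n =>
        Submodule.span k {x | ∃ v : FreeMonoid S, v.length = n ∧
          x = OSq.mk q (circuits M) (FreeAlgebra.basisFreeMonoid k S v)}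
      IsStandardGraded k 𝒜 ∧
        hilbertSeries k 𝒜 = PowerSeries.mk fun n => (nbcCount M n : ℚ) := by
    rintro _ rfl 𝒜
    have h𝒜 : 𝒜 = degreePart (nbcBasis hE hloop (0 : k)) fun K => K.1.card :=
      funext fun n => osPart_eq hE hloop n
    rw [h𝒜]
    refine ⟨isStandardGraded_osPart hE hloop, ?_⟩
    rw [hilbertSeries]
    congr 1
    ext1 n
    rw [finrank_degreePart, nbcCount_eq_natCard]
  exact h 0 (by simp)

end Hilbert

end

end OSDeform

open OSDeform
theorem corollary1p3 {S : Type*} [LinearOrder S] [Finite S]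
    (M : Matroid S) (hE : M.E = Set.univ)
    (hloop : M.Loopless) (hpar : ∀ e f : S, e ≠ f → ¬ M.IsCircuit {e, f})
    (Q : Type*) [CommRing Q] :
    IsGroebnerBasis
        (generators (Polynomial.X ^ 2 : Polynomial Q) (groebnerCircuits (circuits M)))
        (defIdeal (Polynomial.X ^ 2 : Polynomial Q) (circuits M)) ∧
      Module.Free Q (OSq (Polynomial.X ^ 2 : Polynomial Q) (circuits M)) ∧
      IsStandardGraded Q (homogPart Q (circuits M)) ∧
      (∀ n, Module.Free Q (homogPart Q (circuits M) n) ∧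
        Module.Finite Q (homogPart Q (circuits M) n)) ∧
      (Nontrivial Q →
        hilbertSeries Q (homogPart Q (circuits M)) =
            (1 + ∑ i ∈ Finset.Icc 1 M.eRank.toNat,
              PowerSeries.C (nbcCount M i : ℚ) * PowerSeries.X ^ i) *
              (1 - PowerSeries.X)⁻¹ ∧
          ∀ (k : Type*) [Field k],
            IsStandardGraded k (osPart k (circuits M)) ∧
            hilbertSeries Q (homogPart Q (circuits M)) =
              hilbertSeries k (osPart k (circuits M)) * (1 - PowerSeries.X)⁻¹) := by
  refine ⟨isGroebnerBasis_generators hE hloop, Module.Free.of_basis (nbcPolyBasis Q hE hloop),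
    isStandardGraded_homogPart hE hloop, fun n => ?_, fun _ => ⟨?_, fun k _ => ?_⟩⟩
  · have := finite_polyDegree (circuits M) n
    rw [homogPart_eq hE hloop]
    exact ⟨Module.Free.of_basis (degreePartBasis _ _ n),
      Module.Finite.of_basis (degreePartBasis _ _ n)⟩
  · rw [hilbertSeries_homogPart hE hloop, powerSeries_mk_nbcCount hE hloop]
  · obtain ⟨h1, h2⟩ := isStandardGraded_and_hilbertSeries_osPart (k := k) hE hloop
    exact ⟨h1, by rw [hilbertSeries_homogPart hE hloop, h2]⟩
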